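/- Let $m,K\ge 1$ and $n,l\ge 0$ be integers with $K\le m$, let $\mathcal X\subseteq\mathbb R^n$, $\mathbf A\in\mathbb R^{l\times m}$, $\mathbf b\in\mathbb R^l$, $\boldsymbol\mu\in\mathbb R^m$, $\gamma_1\ge 0$, $\gamma_2\ge 1$, and let $\boldsymbol\Sigma=\mathbf U\boldsymbol\Lambda\mathbf U^\top\succ 0$ be an eigendecomposition of an $m\times m$ matrix, with $\mathbf U$ orthogonal and $\boldsymbol\Lambda$ diagonal with nonincreasing diagonal entries. Suppose that the polyhedron $\mathcal S=\{\boldsymbol\xi\in\mathbb R^m:\mathbf A\boldsymbol\xi\le\mathbf b\}$ has an interior point and that $f(\mathbf x,\boldsymbol\xi)=\max_{k=1}^K\{y_k^0(\mathbf x)+y_k(\mathbf x)^\top\boldsymbol\xi\}$ with $y_k^0(\mathbf x)\in\mathbb R$ and $y_k(\mathbf x)\in\mathbb R^m$ affine in $\mathbf x$. Put $\mathbf W=\mathbf U\boldsymbol\Lambda^{1/2}$, $\mathcal S_{\rm I}=\{\boldsymbol\xi\in\mathbb R^m:\mathbf W\boldsymbol\xi+\boldsymbol\mu\in\mathcal S\}$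 and $\mathbf A\bullet\mathbf B=\sum_{i,j}A_{ij}B_{ij}$. All optimal values are infima and suprema in $[-\infty,+\infty]$, with $\inf\emptyset=+\infty$ and $\sup\emptyset=-\infty$. Let $\Theta_{\rm M}(m)$ be the optimal value of the original problem $$\min_{\mathbf x\in\mathcal X}\ \max_{\mathbb P\in\mathcal D_{\rm M}}\ \mathbb E_{\mathbb P}[f(\mathbf x,\mathbf W\boldsymbol\xi+\boldsymbol\mu)],$$ where $\mathcal D_{\rm M}$ is the set of probability distributions $\mathbb P$ of $\boldsymbol\xi\in\mathbb R^m$ with $\mathbb P(\boldsymbol\xi\in\mathcal S_{\rm I})=1$, $\mathbb E_{\mathbb P}[\boldsymbol\xi]^\top\mathbb E_{\mathbb P}[\boldsymbol\xi]\le\gamma_1$ and $\mathbb E_{\mathbb P}[\boldsymbol\xi\boldsymbol\xi^\top]\preceq\gamma_2\mathbf I_m$ (these moments being finite). It is also the optimal value of the semidefinite program that minimizes $s+\gamma_2\mathbf I_m\bullet\mathbf Q+\sqrt{\gamma_1}\|\mathbf q\|_2$ over $\mathbf x\in\mathcal X$, $s\in\mathbb R$, $\boldsymbol\lambda_1,\dots,\boldsymbol\lambda_K\in\mathbb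 R^l_+$, $\mathbf q\in\mathbb R^m$, $\mathbf Q\in\mathbb R^{m\times m}$ subject to $$\begin{bmatrix} S_k&\tfrac12\mathbf h_k^\top\\ \tfrac12\mathbf h_k&\mathbf Q\end{bmatrix}\succeq 0\quad(1\le k\le K),$$ where $$S_k=s-y_k^0(\mathbf x)-\boldsymbol\lambda_k^\top\mathbf b-y_k(\mathbf x)^\top\boldsymbol\mu+\boldsymbol\lambda_k^\top\mathbf A\boldsymbol\mu,\qquad \mathbf h_k=\mathbf q+\mathbf W^\top(\mathbf A^\top\boldsymbol\lambda_k-y_k(\mathbf x)).$$ For an integer $0\le m_1\le K$ consider the second outer approximation $$\min_{\mathbf B}\ \min_{\mathbf x\in\mathcal X}\ \max_{\mathbb P\in\mathcal D_{\rm L2}}\ \mathbb E_{\mathbb P}[f(\mathbf x,\mathbf W\boldsymbol\xi+\boldsymbol\mu)],$$ where $\mathbf B=[\mathbf B_1,\mathbf B_2]$ ranges over the matrices in $\mathbb R^{m\times K}$ with $\mathbf B^\top\mathbf B=\mathbf I_K$, $\mathbf B_1\in\mathbb R^{m\times m_1}$, $\mathbf B_2\in\mathbb R^{m\times(K-m_1)}$,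 and $\mathcal D_{\rm L2}$ (which depends on $\mathbf B$) is the set of probability distributions of $\boldsymbol\xi\in\mathbb R^m$ with $\mathbb P(\boldsymbol\xi\in\mathcal S_{\rm I})=1$, $\mathbb E_{\mathbb P}[\boldsymbol\xi]^\top\mathbb E_{\mathbb P}[\boldsymbol\xi]\le\gamma_1$, $\mathbb E_{\mathbb P}[\mathbf B_1^\top\boldsymbol\xi\boldsymbol\xi^\top\mathbf B_1]\preceq\gamma_2\mathbf I_{m_1}$ and $\mathbb E_{\mathbb P}[\mathbf B_2^\top\boldsymbol\xi\boldsymbol\xi^\top\mathbf B_2]\preceq\mathbf 0$ (these moments being finite). This problem has the same optimal value as the low-dimensional semidefinite program $$\begin{aligned}\Theta_{\rm L2}(m_1)=\min\ & s+\gamma_2\mathbf I_{m_1}\bullet\mathbf Q'+\sqrt{\gamma_1}\|\mathbf q\|_2\\ \text{s.t. }&\begin{bmatrix} S_k&\tfrac12(\mathbf u_k')^\top\\ \tfrac12\mathbf u_k'&\mathbf Q'\end{bmatrix}\succeq 0,\qquad \mathbf h_k=\mathbf B_1\mathbf u_k'+\mathbf B_2\mathbf u_k''\qquad(1\le k\le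 K),\\ &[\mathbf B_1,\mathbf B_2]^\top[\mathbf B_1,\mathbf B_2]=\mathbf I_K,\end{aligned}$$ with $S_k$ and $\mathbf h_k$ as above, over $\mathbf x\in\mathcal X$, $s\in\mathbb R$, $\boldsymbol\lambda_k\in\mathbb R^l_+$, $\mathbf q\in\mathbb R^m$, $\mathbf Q'\in\mathbb R^{m_1\times m_1}$, $\mathbf u_k'\in\mathbb R^{m_1}$, $\mathbf u_k''\in\mathbb R^{K-m_1}$, $\mathbf B_1\in\mathbb R^{m\times m_1}$, $\mathbf B_2\in\mathbb R^{m\times(K-m_1)}$. Moreover, (i) $\Theta_{\rm L2}(m_1)\le\Theta_{\rm M}(m)$ for every $m_1\le K$; (ii) $\Theta_{\rm L2}(m_1)\le\Theta_{\rm L2}(m_2)$ whenever $m_1<m_2\le K$; and (iii) $\Theta_{\rm L2}(K)=\Theta_{\rm M}(m)$. -/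

import Mathlib

open Matrix MeasureTheory

noncomputable section

/-- The data of a moment-based distributionally robust problem: decision vectors in `ℝⁿ`, random
vectors in `ℝᵐ`, a support polyhedron given by `l` inequalities, and an objective with `K` affine
pieces in the random vector. The eigendecomposition of `Sigma` is `U`, `lam`. -/
structure MomentDRO (n m l K : ℕ) where
  /-- feasible set of the decision vector -/
  X : Set (Fin n → ℝ)
  /-- constant terms of the pieces, affine in the decision -/
  y0 : Fin K → ((Fin n → ℝ) →ᵃ[ℝ] ℝ)
  /-- slopes of the pieces, affine in the decision -/
  y : Fin K → ((Fin n → ℝ) →ᵃ[ℝ] (Fin m → ℝ))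
  /-- constraint matrix of the support polyhedron -/
  A : Matrix (Fin l) (Fin m) ℝ
  /-- right-hand side of the support polyhedron -/
  b : Fin l → ℝ
  /-- centre of the mean ellipsoid -/
  mu : Fin m → ℝ
  /-- covariance matrix -/
  Sigma : Matrix (Fin m) (Fin m) ℝ
  /-- matrix of eigenvectors -/
  U : Matrix (Fin m) (Fin m) ℝ
  /-- eigenvalues -/
  lam : Fin m → ℝ
  /-- size of the mean ellipsoid -/
  gamma1 : ℝ
  /-- factor of the covariance bound -/
  gamma2 : ℝ

/-- The inner product `A • B = ∑ i j, A i j * B i j` of two matrices. -/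
def matInner {ι κ : Type*} [Fintype ι] [Fintype κ] (A B : Matrix ι κ ℝ) : ℝ :=
  ∑ i, ∑ j, A i j * B i j

/-- The Euclidean norm of a vector. -/
def l2norm {ι : Type*} [Fintype ι] (q : ι → ℝ) : ℝ := ‖WithLp.toLp 2 q‖

/-- The bordered matrix `[a, (1/2) uᵀ; (1/2) u, Q]`. -/
def bordered {ι : Type*} (a : ℝ) (u : ι → ℝ) (Q : Matrix ι ι ℝ) :
    Matrix (Unit ⊕ ι) (Unit ⊕ ι) ℝ :=
  fromBlocks (Matrix.of fun _ _ => a) (Matrix.of fun _ j => (1 / 2 : ℝ) * u j)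
    (Matrix.of fun i _ => (1 / 2 : ℝ) * u i) Q

/-- The mean vector of a distribution on `ℝᵐ`. -/
def meanVec {m : ℕ} (ν : Measure (Fin m → ℝ)) : Fin m → ℝ := fun i => ∫ ξ, ξ i ∂ν

/-- The second-moment matrix `E[Z Zᵀ]` of a random vector `Z`. -/
def momentMatrix {m : ℕ} {ι : Type*} (ν : Measure (Fin m → ℝ))
    (Z : (Fin m → ℝ) → (ι → ℝ)) : Matrix ι ι ℝ :=
  Matrix.of fun i j => ∫ ξ, Z ξ i * Z ξ j ∂ν

/-- `E[Z Zᵀ]` exists and `E[Z Zᵀ] ⪯ M`. -/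
def SecondMomentLE {m : ℕ} {ι : Type*} [Fintype ι] (ν : Measure (Fin m → ℝ))
    (Z : (Fin m → ℝ) → (ι → ℝ)) (M : Matrix ι ι ℝ) : Prop :=
  (∀ i j, Integrable (fun ξ => Z ξ i * Z ξ j) ν) ∧ (M - momentMatrix ν Z).PosSemidef

namespace MomentDRO

variable {n m l K : ℕ}

/-- The polyhedral support `{ξ | A ξ ≤ b}`. -/
def S (P : MomentDRO n m l K) : Set (Fin m → ℝ) := {ξ | P.A *ᵥ ξ ≤ P.b}

/-- The piecewise linear convex objective, the maximum of its `K` affine pieces. -/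
def f (P : MomentDRO n m l K) (x : Fin n → ℝ) (ξ : Fin m → ℝ) : ℝ :=
  ⨆ k : Fin K, (P.y0 k x + P.y k x ⬝ᵥ ξ)

/-- The matrix `U Λ^(1/2)`. -/
def W (P : MomentDRO n m l K) : Matrix (Fin m) (Fin m) ℝ :=
  P.U * Matrix.diagonal fun i => Real.sqrt (P.lam i)

/-- The support of the standardized random vector. -/
def SI (P : MomentDRO n m l K) : Set (Fin m → ℝ) := {ξ | P.W *ᵥ ξ + P.mu ∈ P.S}

/-- The standing assumptions: `gamma1 ≥ 0`, `gamma2 ≥ 1`, a positive definite covariance matrix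
with its eigendecomposition in nonincreasing order, and a support with an interior point. -/
structure Standing (P : MomentDRO n m l K) : Prop where
  gamma1_nonneg : 0 ≤ P.gamma1
  one_le_gamma2 : 1 ≤ P.gamma2
  sigma_posDef : P.Sigma.PosDef
  orthogonal : P.Uᵀ * P.U = 1
  decomposition : P.Sigma = P.U * Matrix.diagonal P.lam * P.Uᵀ
  nonincreasing : Antitone P.lam
  interior_nonempty : (interior P.S).Nonempty

/-- Support and mean conditions common to the ambiguity sets. -/
def SupportMean (P : MomentDRO n m l K) (ν : Measure (Fin m → ℝ)) : Prop :=
  IsProbabilityMeasure ν ∧ ν P.SI = 1 ∧ (∀ i, Integrable (fun ξ : Fin m → ℝ => ξ i) ν) ∧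
    meanVec ν ⬝ᵥ meanVec ν ≤ P.gamma1

/-- The ambiguity set of the original problem. -/
def DM (P : MomentDRO n m l K) : Set (Measure (Fin m → ℝ)) :=
  {ν | P.SupportMean ν ∧ SecondMomentLE ν (fun ξ => ξ) (P.gamma2 • 1)}

/-- The ambiguity set of the second outer approximation: the second moment of `B₁ᵀ ξ` is bounded
by `gamma2 • I` and that of `B₂ᵀ ξ` by the zero matrix. -/
def DL2 (P : MomentDRO n m l K) {m₁ m₂ : ℕ} (B₁ : Matrix (Fin m) (Fin m₁) ℝ)
    (B₂ : Matrix (Fin m) (Fin m₂) ℝ) : Set (Measure (Fin m → ℝ)) :=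
  {ν | P.SupportMean ν ∧ SecondMomentLE ν (fun ξ => B₁ᵀ *ᵥ ξ) (P.gamma2 • 1) ∧
    SecondMomentLE ν (fun ξ => B₂ᵀ *ᵥ ξ) 0}

/-- The worst-case expected objective over a set of distributions of the standardized vector. -/
def worstCase (P : MomentDRO n m l K) (D : Set (Measure (Fin m → ℝ))) (x : Fin n → ℝ) : EReal :=
  ⨆ ν ∈ D, ((∫ ξ, P.f x (P.W *ᵥ ξ + P.mu) ∂ν : ℝ) : EReal)

/-- `Θ_M(m)`, the optimal value of the original distributionally robust problem. -/
def thetaM (P : MomentDRO n m l K) : EReal := ⨅ x ∈ P.X, P.worstCase P.DM x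

/-- `[B₁, B₂]ᵀ [B₁, B₂] = I`. -/
def Orthonormal₂ {m m₁ m₂ : ℕ} (B₁ : Matrix (Fin m) (Fin m₁) ℝ)
    (B₂ : Matrix (Fin m) (Fin m₂) ℝ) : Prop :=
  (fromCols B₁ B₂)ᵀ * fromCols B₁ B₂ = 1

/-- The optimal value of the second outer approximation
`min over B = [B₁, B₂] and x of the worst case over DL2`. -/
def outerL2 (P : MomentDRO n m l K) (m₁ : ℕ) : EReal :=
  ⨅ (B₁ : Matrix (Fin m) (Fin m₁) ℝ) (B₂ : Matrix (Fin m) (Fin (K - m₁)) ℝ)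
    (_ : Orthonormal₂ B₁ B₂), ⨅ x ∈ P.X, P.worstCase (P.DL2 B₁ B₂) x

/-- The upper left entry
`s - y_k⁰(x) - λ_kᵀ b - y_k(x)ᵀ μ + λ_kᵀ A μ` of the semidefinite constraints. -/
def corner (P : MomentDRO n m l K) (x : Fin n → ℝ) (s : ℝ) (Lk : Fin l → ℝ) (k : Fin K) : ℝ :=
  s - P.y0 k x - Lk ⬝ᵥ P.b - P.y k x ⬝ᵥ P.mu + Lk ⬝ᵥ (P.A *ᵥ P.mu)

/-- The vector `q + (U Λ^(1/2))ᵀ (Aᵀ λ_k - y_k(x))`. -/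
def side (P : MomentDRO n m l K) (x : Fin n → ℝ) (Lk : Fin l → ℝ) (q : Fin m → ℝ)
    (k : Fin K) : Fin m → ℝ :=
  q + P.Wᵀ *ᵥ (P.Aᵀ *ᵥ Lk - P.y k x)

/-- The objective `s + gamma2 (I • Q) + √gamma1 ‖q‖₂` of the semidefinite programs. -/
def objective (P : MomentDRO n m l K) {r : ℕ} (s : ℝ) (q : Fin m → ℝ)
    (Q : Matrix (Fin r) (Fin r) ℝ) : ℝ :=
  s + P.gamma2 * matInner 1 Q + Real.sqrt P.gamma1 * l2norm q

/-- Feasibility in the semidefinite formulation of the original problem. -/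
def MFeasible (P : MomentDRO n m l K) (x : Fin n → ℝ) (s : ℝ) (L : Fin K → Fin l → ℝ)
    (q : Fin m → ℝ) (Q : Matrix (Fin m) (Fin m) ℝ) : Prop :=
  x ∈ P.X ∧ (∀ k, 0 ≤ L k) ∧
    ∀ k, (bordered (P.corner x s (L k) k) (P.side x (L k) q k) Q).PosSemidef

/-- The optimal value of the semidefinite formulation of the original problem. -/
def sdpM (P : MomentDRO n m l K) : EReal :=
  sInf {v | ∃ x s L q Q, P.MFeasible x s L q Q ∧ v = ((P.objective s q Q : ℝ) : EReal)}

/-- Feasibility in the low-dimensional semidefinite program, in which `B₁` and `B₂` are decision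
variables too. -/
def L2Feasible (P : MomentDRO n m l K) (m₁ : ℕ) (x : Fin n → ℝ) (s : ℝ) (L : Fin K → Fin l → ℝ)
    (q : Fin m → ℝ) (Q' : Matrix (Fin m₁) (Fin m₁) ℝ) (u' : Fin K → Fin m₁ → ℝ)
    (u'' : Fin K → Fin (K - m₁) → ℝ) (B₁ : Matrix (Fin m) (Fin m₁) ℝ)
    (B₂ : Matrix (Fin m) (Fin (K - m₁)) ℝ) : Prop :=
  x ∈ P.X ∧ (∀ k, 0 ≤ L k) ∧ Orthonormal₂ B₁ B₂ ∧
    (∀ k, (bordered (P.corner x s (L k) k) (u' k) Q').PosSemidef) ∧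
    ∀ k, P.side x (L k) q k = B₁ *ᵥ u' k + B₂ *ᵥ u'' k

/-- `Θ_L2(m₁)`, the optimal value of the low-dimensional semidefinite program. -/
def thetaL2 (P : MomentDRO n m l K) (m₁ : ℕ) : EReal :=
  sInf {v | ∃ x s L q Q' u' u'' B₁ B₂, P.L2Feasible m₁ x s L q Q' u' u'' B₁ B₂ ∧
    v = ((P.objective s q Q' : ℝ) : EReal)}

end MomentDRO

end

/-!
For fixed `B = [B₁, B₂]` and fixed `x`, the worst case over `DL2` and the semidefinite program are a
dual pair, and the theorem rests on strong duality for it.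

*Weak duality* (`DualFeasible.worstCase_le`): a feasible point of the program gives the majorant
`s + q ⬝ ξ + ηᵀ Q η`, with `η = B₁ᵀ ξ`, of the objective on the support, because the bordered matrices
are positive semidefinite at `(1, η)` and `B₂ᵀ ξ = 0` almost surely.

*Strong duality* (`le_worstCase_of_linFeasible`): call the constraints `λ ≥ 0` and
`h_k = B₁ u'_k + B₂ u''_k` the polyhedral part. If it is consistent, then large `s` and `Q = 1` give a
Slater point for the remaining, semidefinite constraints, so separation of an open cone from a convex
set produces multipliers for these (`exists_multipliers`), and Farkas' lemma produces multipliers of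
the linear equations (`exists_equation_multipliers`). Together they form a point `(w, v)` of the conic
dual, which is the distribution with atoms `v k / w k` of masses `w k` as soon as all masses are
positive. This is achieved by mixing in a small multiple of the point mass at the mean
`∑ k, v k`, which changes neither the mean nor feasibility (`ConicFeasible.mix`).

For an unfavourable `B` the polyhedral part can be inconsistent when `K < m`. Then Farkas' lemma gives
directions orthogonal to `B` along which mass can be spread so that the expected objective tends to
infinity, provided that `DL2` is nonempty (`worstCase_eq_top`). If `DL2` is empty and `m₁ < K`, then
the program is unbounded below for another `B` (`thetaL2_eq_bot`). Hence minimizing over `B` closes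
every gap. For `m₁ = K` the equality follows from `DM ⊆ DL2` and the comparison of the programs.

The original problem is the case `B₁ = 1` with empty `B₂`, where the polyhedral part is always
consistent (`thetaM_eq_sdpM`). The comparison of the programs is linear algebra: an orthonormal system
whose range contains the `K` vectors `h_k` compresses `Q` without increasing its trace
(`thetaL2_le_sdpM`), moving columns from `B₁` to `B₂` passes to a principal submatrix of `Q'`
(`thetaL2_mono`), and for `m₁ = K` the matrix `B₁ Q' B₁ᵀ` is feasible for the original program
(`sdpM_le_thetaL2`).
-/

/-! ### Linear inequalities -/

theorem farkas_fin {V : Type*} [AddCommGroup V] [Module ℝ V] :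
    ∀ (r : ℕ) (A : Fin r → V →ₗ[ℝ] ℝ) (b : V →ₗ[ℝ] ℝ),
      (∀ x, (∀ i, A i x ≤ 0) → b x ≤ 0) →
      ∃ U : Fin r → ℝ, (∀ i, 0 ≤ U i) ∧ ∀ x, b x = ∑ i, U i * A i x
  | 0, A, b, h => by
    refine ⟨fun _ => 0, fun _ => le_rfl, fun x => ?_⟩
    have h1 := h x (fun i => i.elim0)
    have h2 := h (-x) (fun i => i.elim0)
    rw [map_neg] at h2
    simp only [Finset.univ_eq_empty, Finset.sum_empty]
    linarith
  | r + 1, A, b, h => by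
    by_cases h0 : ∀ x, (∀ i : Fin r, A i.castSucc x ≤ 0) → b x ≤ 0
    · obtain ⟨U, hU, hb⟩ := farkas_fin r (fun i => A i.castSucc) b h0
      refine ⟨Fin.snoc U 0, fun i => ?_, fun x => ?_⟩
      · refine Fin.lastCases ?_ (fun i => ?_) i
        · simp
        · simpa using hU i
      · rw [Fin.sum_univ_castSucc]
        simpa using hb x
    · push Not at h0
      obtain ⟨y, hy, hby⟩ := h0
      have hay : 0 < A (Fin.last r) y := by
        by_contra hcon
        refine absurd (h y fun i => ?_) (not_le.mpr hby)
        exact Fin.lastCases (not_lt.mp hcon) hy i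
      -- Project along the violating point `y` onto the kernel of the last functional.
      set a := A (Fin.last r) with ha
      let z : V := (a y)⁻¹ • y
      have haz : a z = 1 := by simp [z, hay.ne']
      have hz : ∀ i : Fin r, A i.castSucc z ≤ 0 := fun i => by
        simp only [z, map_smul, smul_eq_mul]
        exact mul_nonpos_of_nonneg_of_nonpos (inv_nonneg.2 hay.le) (hy i)
      have hbz : 0 < b z := by
        simp only [z, map_smul, smul_eq_mul]
        exact mul_pos (inv_pos.2 hay) hby
      let π : V →ₗ[ℝ] V := LinearMap.id - a.smulRight z
      have hπ : ∀ x, π x = x - a x • z := fun x => by simp [π]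
      obtain ⟨U, hU, hb⟩ := farkas_fin r (fun i => (A i.castSucc).comp π) (b.comp π) (by
        intro x hx
        refine h (π x) fun i => ?_
        refine Fin.lastCases ?_ hx i
        rw [← ha, hπ]
        simp [haz])
      refine ⟨Fin.snoc U (b z - ∑ i, U i * A i.castSucc z), fun i => ?_, fun x => ?_⟩
      · refine Fin.lastCases ?_ (fun i => ?_) i
        · have : ∑ i, U i * A i.castSucc z ≤ 0 :=
            Finset.sum_nonpos fun i _ => mul_nonpos_of_nonneg_of_nonpos (hU i) (hz i)
          simp only [Fin.snoc_last]
          linarith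
        · simpa using hU i
      · rw [Fin.sum_univ_castSucc]
        have := hb x
        simp only [LinearMap.comp_apply, hπ, map_sub, map_smul, smul_eq_mul, mul_sub,
          Finset.sum_sub_distrib] at this
        have h3 : ∑ i, U i * (a x * A i.castSucc z) = a x * ∑ i, U i * A i.castSucc z := by
          rw [Finset.mul_sum]
          exact Finset.sum_congr rfl fun i _ => by ring
        simp only [Fin.snoc_castSucc, Fin.snoc_last]
        rw [← ha]
        rw [h3] at this
        linarith

/-- **Farkas' lemma** for finitely many homogeneous linear inequalities and equations. -/
theorem farkas {V ι κ : Type*} [AddCommGroup V] [Module ℝ V] [Fintype ι] [Fintype κ]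
    (A : ι → V →ₗ[ℝ] ℝ) (E : κ → V →ₗ[ℝ] ℝ) (b : V →ₗ[ℝ] ℝ)
    (h : ∀ x, (∀ i, A i x ≤ 0) → (∀ j, E j x = 0) → b x ≤ 0) :
    ∃ (U : ι → ℝ) (T : κ → ℝ), (∀ i, 0 ≤ U i) ∧
      ∀ x, b x = ∑ i, U i * A i x + ∑ j, T j * E j x := by
  let G : ι ⊕ κ ⊕ κ → V →ₗ[ℝ] ℝ := Sum.elim A (Sum.elim E fun j => -E j)
  let e := Fintype.equivFin (ι ⊕ κ ⊕ κ)
  obtain ⟨U, hU, hb⟩ := farkas_fin _ (fun i => G (e.symm i)) b (by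
    intro x hx
    have hx' : ∀ i, G i x ≤ 0 := fun i => by simpa using hx (e i)
    refine h x (fun i => hx' (.inl i)) fun j => le_antisymm (hx' (.inr (.inl j))) ?_
    have := hx' (.inr (.inr j))
    simpa [G] using this)
  refine ⟨fun i => U (e (.inl i)), fun j => U (e (.inr (.inl j))) - U (e (.inr (.inr j))),
    fun i => hU _, fun x => ?_⟩
  rw [hb x, ← e.sum_comp]
  simp only [Equiv.symm_apply_apply, Fintype.sum_sum_type, G, Sum.elim_inl, Sum.elim_inr,
    LinearMap.neg_apply, sub_mul, Finset.sum_sub_distrib, mul_neg, Finset.sum_neg_distrib]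
  ring

/-! ### Euclidean norm -/

section l2norm
variable {ι : Type*} [Fintype ι]

theorem l2norm_sq (q : ι → ℝ) : l2norm q ^ 2 = q ⬝ᵥ q := by
  rw [l2norm, EuclideanSpace.norm_sq_eq]
  simp [dotProduct, sq]

theorem l2norm_nonneg (q : ι → ℝ) : 0 ≤ l2norm q := norm_nonneg _

theorem l2norm_zero : l2norm (0 : ι → ℝ) = 0 := by simp [l2norm]

theorem l2norm_add_le (p q : ι → ℝ) : l2norm (p + q) ≤ l2norm p + l2norm q := by
  simpa [l2norm] using norm_add_le (WithLp.toLp 2 p) (WithLp.toLp 2 q)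

theorem l2norm_smul {c : ℝ} (hc : 0 ≤ c) (q : ι → ℝ) : l2norm (c • q) = c * l2norm q := by
  simp [l2norm, norm_smul, abs_of_nonneg hc]

theorem continuous_l2norm : Continuous (l2norm : (ι → ℝ) → ℝ) :=
  continuous_norm.comp (PiLp.continuous_toLp 2 _)

theorem dotProduct_le_l2norm_mul (p q : ι → ℝ) : p ⬝ᵥ q ≤ l2norm p * l2norm q := by
  have := real_inner_le_norm (WithLp.toLp 2 p) (WithLp.toLp 2 q)
  rw [EuclideanSpace.inner_toLp_toLp] at this
  simpa [l2norm, dotProduct_comm] using this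

theorem l2norm_le_sqrt {q : ι → ℝ} {c : ℝ} (h : q ⬝ᵥ q ≤ c) : l2norm q ≤ √c := by
  rw [← l2norm_sq] at h
  exact Real.le_sqrt_of_sq_le h

theorem real_dotProduct_self_nonneg (q : ι → ℝ) : 0 ≤ q ⬝ᵥ q := by
  rw [← l2norm_sq]; positivity

end l2norm

/-! ### Positive semidefinite bordered matrices -/

section PSD
variable {ι κ : Type*} [Fintype ι] [Fintype κ]

/-- The quadratic form of the bordered matrix `[a, (1/2) uᵀ; (1/2) u, Q]` at the vector
`(t, η)`. -/
noncomputable def borderedForm (a : ℝ) (u : ι → ℝ) (Q : Matrix ι ι ℝ) (t : ℝ) (η : ι → ℝ) : ℝ :=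
  a * t ^ 2 + t * (u ⬝ᵥ η) + η ⬝ᵥ (Q *ᵥ η)

theorem posSemidef_iff_real {Q : Matrix ι ι ℝ} :
    Q.PosSemidef ↔ Q.IsSymm ∧ ∀ η, 0 ≤ η ⬝ᵥ (Q *ᵥ η) := by
  rw [posSemidef_iff_dotProduct_mulVec]
  simp [IsHermitian, IsSymm, conjTranspose_eq_transpose_of_trivial]

theorem dotProduct_bordered (a : ℝ) (u : ι → ℝ) (Q : Matrix ι ι ℝ) (z : Unit ⊕ ι → ℝ) :
    z ⬝ᵥ (bordered a u Q *ᵥ z) = borderedForm a u Q (z (.inl ())) (fun i => z (.inr i)) := by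
  have h : z = Sum.elim (fun _ => z (.inl ())) (fun i => z (.inr i)) := by
    ext (i | i) <;> rfl
  conv_lhs => rw [h]
  rw [bordered, fromBlocks_mulVec, sumElim_dotProduct_sumElim]
  simp only [borderedForm, dotProduct, Finset.univ_unique, Finset.sum_singleton, mulVec,
    Pi.add_apply, Matrix.of_apply, Function.comp, Sum.elim_inl, Sum.elim_inr, mul_add,
    Finset.sum_add_distrib, Finset.mul_sum, Pi.add_apply]
  have h3 : ∀ x, z (.inl ()) * (1 / 2 * u x * z (.inr x)) + z (.inr x) *
      (1 / 2 * u x * z (.inl ())) = z (.inl ()) * (u x * z (.inr x)) := fun x => by ring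
  rw [← Finset.sum_congr rfl fun x _ => h3 x, Finset.sum_add_distrib]
  ring

theorem bordered_posSemidef_iff {a : ℝ} {u : ι → ℝ} {Q : Matrix ι ι ℝ} :
    (bordered a u Q).PosSemidef ↔ Q.IsSymm ∧ ∀ t η, 0 ≤ borderedForm a u Q t η := by
  rw [posSemidef_iff_real]
  have hs : (bordered a u Q).IsSymm ↔ Q.IsSymm := by
    simp only [IsSymm, bordered, fromBlocks_transpose]
    rw [fromBlocks_inj]
    refine ⟨fun h => h.2.2.2, fun h => ⟨rfl, ?_, ?_, h⟩⟩ <;> rfl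
  rw [hs]
  refine and_congr_right fun _ => ⟨fun h t η => ?_, fun h z => ?_⟩
  · simpa [dotProduct_bordered] using h (Sum.elim (fun _ => t) η)
  · rw [dotProduct_bordered]
    exact h _ _

theorem bordered_posSemidef_block {a : ℝ} {u : ι → ℝ} {Q : Matrix ι ι ℝ}
    (h : (bordered a u Q).PosSemidef) : Q.PosSemidef := by
  rw [bordered_posSemidef_iff] at h
  exact posSemidef_iff_real.2 ⟨h.1, fun η => by simpa [borderedForm] using h.2 0 η⟩

theorem bordered_posSemidef_corner {a : ℝ} {u : ι → ℝ} {Q : Matrix ι ι ℝ}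
    (h : (bordered a u Q).PosSemidef) : 0 ≤ a := by
  rw [bordered_posSemidef_iff] at h
  simpa [borderedForm] using h.2 1 0

theorem borderedForm_one_le {a : ℝ} {u : ι → ℝ} (t : ℝ) (η : ι → ℝ) [DecidableEq ι] :
    (a - u ⬝ᵥ u) * t ^ 2 + 3 / 4 * (η ⬝ᵥ η) ≤ borderedForm a u 1 t η := by
  have h := real_dotProduct_self_nonneg (t • u + (1 / 2 : ℝ) • η)
  simp only [dotProduct_add, add_dotProduct, smul_dotProduct, dotProduct_smul, smul_eq_mul] at h
  rw [dotProduct_comm η u] at h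
  simp only [borderedForm, one_mulVec]
  linarith

theorem bordered_one_posSemidef [DecidableEq ι] {a : ℝ} {u : ι → ℝ} (h : u ⬝ᵥ u ≤ a) :
    (bordered a u 1).PosSemidef := by
  refine bordered_posSemidef_iff.2 ⟨isSymm_one, fun t η => ?_⟩
  have h1 := borderedForm_one_le (a := a) (u := u) t η
  have h2 := real_dotProduct_self_nonneg η
  have h3 : 0 ≤ (a - u ⬝ᵥ u) * t ^ 2 := mul_nonneg (by linarith) (sq_nonneg t)
  linarith

theorem matInner_one [DecidableEq ι] (Q : Matrix ι ι ℝ) : matInner 1 Q = Q.trace := by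
  simp [matInner, one_apply, trace]

theorem trace_mul_nonneg_of_posSemidef {M N : Matrix ι ι ℝ} (hM : M.PosSemidef)
    (hN : N.PosSemidef) : 0 ≤ (M * N).trace := by
  classical
  obtain ⟨C, rfl⟩ : ∃ C : Matrix ι ι ℝ, M = Cᴴ * C := by
    open scoped MatrixOrder in
    exact CStarAlgebra.nonneg_iff_eq_star_mul_self.mp hM.nonneg
  rw [trace_mul_comm, ← Matrix.mul_assoc, trace_mul_comm, ← Matrix.mul_assoc]
  exact (hN.mul_mul_conjTranspose_same C).trace_nonneg

/-- Compressing to an orthonormal system does not increase the trace of a positive semidefinite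
matrix. -/
theorem trace_compress_le [DecidableEq κ] {Q : Matrix ι ι ℝ} (hQ : Q.PosSemidef)
    {B : Matrix ι κ ℝ} (hB : Bᵀ * B = 1) : (Bᵀ * Q * B).trace ≤ Q.trace := by
  classical
  have hP : (1 - B * Bᵀ : Matrix ι ι ℝ).PosSemidef := by
    have : (1 - B * Bᵀ : Matrix ι ι ℝ) = (1 - B * Bᵀ)ᴴ * (1 - B * Bᵀ) := by
      rw [conjTranspose_eq_transpose_of_trivial]
      simp only [transpose_sub, transpose_one, transpose_mul, transpose_transpose]
      have : B * Bᵀ * (B * Bᵀ) = B * Bᵀ := by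
        rw [Matrix.mul_assoc, ← Matrix.mul_assoc Bᵀ, hB, Matrix.one_mul]
      noncomm_ring
      rw [this]
      abel
    rw [this]
    exact posSemidef_conjTranspose_mul_self _
  have h := trace_mul_nonneg_of_posSemidef hQ hP
  rw [Matrix.mul_sub, Matrix.mul_one, trace_sub, ← Matrix.mul_assoc, trace_mul_comm (Q * B) Bᵀ,
    ← Matrix.mul_assoc] at h
  linarith

end PSD

/-! ### Orthonormal systems of columns -/

namespace MomentDRO

section Orthonormal
variable {m m₁ m₂ : ℕ} {B₁ : Matrix (Fin m) (Fin m₁) ℝ} {B₂ : Matrix (Fin m) (Fin m₂) ℝ}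

theorem orthonormal₂_iff : Orthonormal₂ B₁ B₂ ↔
    B₁ᵀ * B₁ = 1 ∧ B₁ᵀ * B₂ = 0 ∧ B₂ᵀ * B₁ = 0 ∧ B₂ᵀ * B₂ = 1 := by
  rw [Orthonormal₂, transpose_fromCols, fromRows_mul_fromCols, ← fromBlocks_one, fromBlocks_inj]

/-- `K ≤ m` vectors of `ℝᵐ` lie in the range of some orthonormal system `[B₁, B₂]` with `m₁` and
`K - m₁` columns. If `B₂` has a column at all, then the first vector can be arranged to lie in the
range of `B₂`. -/
theorem exists_orthonormal₂ {K : ℕ} (hKm : K ≤ m) (hm₁ : m₁ ≤ K) (g : Fin K → Fin m → ℝ) :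
    ∃ (B₁ : Matrix (Fin m) (Fin m₁) ℝ) (B₂ : Matrix (Fin m) (Fin (K - m₁)) ℝ),
      Orthonormal₂ B₁ B₂ ∧
      (∀ k, g k = B₁ *ᵥ (B₁ᵀ *ᵥ g k) + B₂ *ᵥ (B₂ᵀ *ᵥ g k)) ∧
      ∀ k : Fin K, (k : ℕ) = 0 → m₁ < K → B₁ᵀ *ᵥ g k = 0 := by
  classical
  let F : Fin m → EuclideanSpace ℝ (Fin m) := fun i =>
    if h : (i : ℕ) < K then WithLp.toLp 2 (g ⟨i, h⟩) else 0
  have hcard : Module.finrank ℝ (EuclideanSpace ℝ (Fin m)) = Fintype.card (Fin m) := by simp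
  let b := InnerProductSpace.gramSchmidtOrthonormalBasis hcard F
  have hF : ∀ k : Fin K, F (Fin.castLE hKm k) = WithLp.toLp 2 (g k) := fun k => by simp [F]
  -- The columns of `B₂` are the first `K - m₁` vectors of the Gram-Schmidt basis.
  let σ : Fin m₁ ⊕ Fin (K - m₁) → Fin m := Sum.elim
    (fun i => ⟨K - m₁ + i, by omega⟩) (fun j => ⟨j, by omega⟩)
  have hσ : Function.Injective σ := by
    rintro (i | i) (j | j) h <;> simp only [σ, Sum.elim_inl, Sum.elim_inr, Fin.mk.injEq] at h
    · exact congrArg _ (Fin.ext (by omega))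
    · omega
    · omega
    · exact congrArg _ (Fin.ext (by omega))
  let M : Matrix (Fin m) (Fin m₁ ⊕ Fin (K - m₁)) ℝ := Matrix.of fun i j => b (σ j) i
  have hM : Mᵀ * M = 1 := by
    ext i j
    have := orthonormal_iff_ite.1 b.orthonormal (σ i) (σ j)
    rw [PiLp.inner_apply] at this
    simp only [mul_apply, transpose_apply, M, Matrix.of_apply, one_apply]
    simp only [hσ.eq_iff] at this
    rw [← this]
    exact Finset.sum_congr rfl fun x _ => by simp [mul_comm]
  have hMg : ∀ k j, (Mᵀ *ᵥ g k) j = inner ℝ (b (σ j)) (WithLp.toLp 2 (g k)) := by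
    intro k j
    rw [PiLp.inner_apply]
    simp [mulVec, dotProduct, M, mul_comm]
  have htri : ∀ (k : Fin K) (i : Fin m), (k : ℕ) < i →
      inner ℝ (b i) (WithLp.toLp 2 (g k)) = 0 := by
    intro k i hki
    rw [← hF]
    exact InnerProductSpace.gramSchmidtOrthonormalBasis_inv_triangular hcard F
      (show Fin.castLE hKm k < i from hki)
  have hsplit : M = fromCols M.toCols₁ M.toCols₂ := (fromCols_toCols M).symm
  refine ⟨M.toCols₁, M.toCols₂, ?_, fun k => ?_, fun k hk0 hlt => ?_⟩
  · rw [Orthonormal₂, ← hsplit, hM]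
  · have h1 : g k = M *ᵥ (Mᵀ *ᵥ g k) := by
      have h2 := b.sum_repr' (WithLp.toLp 2 (g k))
      have h3 : ∑ i, inner ℝ (b i) (WithLp.toLp 2 (g k)) • b i =
          ∑ j, inner ℝ (b (σ j)) (WithLp.toLp 2 (g k)) • b (σ j) := by
        rw [← Finset.sum_image (s := Finset.univ) (g := σ)
          (f := fun i => inner ℝ (b i) (WithLp.toLp 2 (g k)) • b i) (fun _ _ _ _ h => hσ h)]
        refine (Finset.sum_subset (Finset.subset_univ _) fun i _ hi => ?_).symm
        rw [htri k i, zero_smul]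
        by_contra hlt
        have hiK : (i : ℕ) < K := by omega
        apply hi
        rw [Finset.mem_image]
        by_cases hi2 : (i : ℕ) < K - m₁
        · exact ⟨.inr ⟨i, hi2⟩, Finset.mem_univ _, rfl⟩
        · refine ⟨.inl ⟨i - (K - m₁), by omega⟩, Finset.mem_univ _, Fin.ext ?_⟩
          simp only [σ, Sum.elim_inl]
          omega
      rw [h3] at h2
      ext i
      have h4 := congrArg (fun v : EuclideanSpace ℝ (Fin m) => v i) h2
      simp only [WithLp.ofLp_sum, Finset.sum_apply, WithLp.ofLp_smul, Pi.smul_apply,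
        smul_eq_mul] at h4
      rw [← h4]
      simp only [mulVec, dotProduct]
      refine Finset.sum_congr rfl fun j _ => ?_
      rw [← hMg]
      simp [M, mulVec, dotProduct, mul_comm]
    conv_lhs => rw [h1, hsplit]
    rw [transpose_fromCols, fromRows_mulVec, fromCols_mulVec]
    simp
  · ext i
    have : (M.toCols₁ᵀ *ᵥ g k) i = (Mᵀ *ᵥ g k) (.inl i) := rfl
    rw [this, hMg, htri]
    · rfl
    · simp only [σ, Sum.elim_inl]
      omega

end Orthonormal

end MomentDRO

/-! ### Comparison of the semidefinite programs -/

/-- Compressing the block of a bordered positive semidefinite matrix along `B`. -/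
theorem bordered_compress {ι κ : Type*} [Fintype ι] [Fintype κ] {a : ℝ} {h : ι → ℝ}
    {Q : Matrix ι ι ℝ} (hQ : (bordered a h Q).PosSemidef) (B : Matrix ι κ ℝ) :
    (bordered a (Bᵀ *ᵥ h) (Bᵀ * Q * B)).PosSemidef := by
  rw [bordered_posSemidef_iff] at hQ ⊢
  refine ⟨?_, fun t η => ?_⟩
  · rw [IsSymm, transpose_mul, transpose_mul, transpose_transpose, hQ.1.eq, Matrix.mul_assoc]
  · have := hQ.2 t (B *ᵥ η)
    simp only [borderedForm] at this ⊢
    convert this using 2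
    · rw [mulVec_transpose, dotProduct_mulVec]
    · rw [← mulVec_mulVec, ← mulVec_mulVec, dotProduct_mulVec η Bᵀ, vecMul_transpose]

namespace MomentDRO

variable {n m l K : ℕ} (P : MomentDRO n m l K)

variable {P} in
theorem MFeasible.sdpM_le {x : Fin n → ℝ} {s : ℝ} {L : Fin K → Fin l → ℝ} {q : Fin m → ℝ}
    {Q : Matrix (Fin m) (Fin m) ℝ} (h : P.MFeasible x s L q Q) :
    P.sdpM ≤ ((P.objective s q Q : ℝ) : EReal) :=
  sInf_le ⟨x, s, L, q, Q, h, rfl⟩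

variable {P} in
theorem L2Feasible.thetaL2_le {m₁ : ℕ} {x : Fin n → ℝ} {s : ℝ} {L : Fin K → Fin l → ℝ}
    {q : Fin m → ℝ} {Q' : Matrix (Fin m₁) (Fin m₁) ℝ} {u' : Fin K → Fin m₁ → ℝ}
    {u'' : Fin K → Fin (K - m₁) → ℝ} {B₁ : Matrix (Fin m) (Fin m₁) ℝ}
    {B₂ : Matrix (Fin m) (Fin (K - m₁)) ℝ} (h : P.L2Feasible m₁ x s L q Q' u' u'' B₁ B₂) :
    P.thetaL2 m₁ ≤ ((P.objective s q Q' : ℝ) : EReal) :=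
  sInf_le ⟨x, s, L, q, Q', u', u'', B₁, B₂, h, rfl⟩

theorem thetaL2_le_sdpM (hKm : K ≤ m) {m₁ : ℕ} (hm₁ : m₁ ≤ K) (hγ : 0 ≤ P.gamma2)
    (hK : 1 ≤ K) : P.thetaL2 m₁ ≤ P.sdpM := by
  refine le_sInf ?_
  rintro _ ⟨x, s, L, q, Q, ⟨hx, hL, hQ⟩, rfl⟩
  obtain ⟨B₁, B₂, hB, hg, -⟩ := exists_orthonormal₂ hKm hm₁ fun k => P.side x (L k) q k
  refine (L2Feasible.thetaL2_le (s := s) (q := q) (Q' := B₁ᵀ * Q * B₁)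
    ⟨hx, hL, hB, fun k => bordered_compress (hQ k) B₁, hg⟩).trans ?_
  rw [EReal.coe_le_coe_iff]
  have := trace_compress_le (bordered_posSemidef_block (hQ ⟨0, hK⟩)) (orthonormal₂_iff.1 hB).1
  simp only [objective, matInner_one]
  gcongr

theorem sdpM_le_thetaL2 : P.sdpM ≤ P.thetaL2 K := by
  refine le_sInf ?_
  rintro _ ⟨x, s, L, q, Q, u', u'', B₁, B₂, ⟨hx, hL, hB, hQ, hside⟩, rfl⟩
  have hB₁ := (orthonormal₂_iff.1 hB).1
  have hside' : ∀ k, P.side x (L k) q k = B₁ᵀᵀ *ᵥ u' k := fun k => by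
    have : IsEmpty (Fin (K - K)) := by rw [Nat.sub_self]; infer_instance
    rw [hside k, transpose_transpose]
    ext i
    simp [mulVec, dotProduct]
  refine (MFeasible.sdpM_le (s := s) (q := q) (Q := B₁ᵀᵀ * Q * B₁ᵀ) ⟨hx, hL, fun k => ?_⟩).trans ?_
  · rw [hside' k]
    exact bordered_compress (hQ k) B₁ᵀ
  · rw [EReal.coe_le_coe_iff]
    simp only [objective, matInner_one]
    rw [trace_mul_comm, ← Matrix.mul_assoc, transpose_transpose, hB₁, Matrix.one_mul]

/-- Moving columns from `B₁` to `B₂` only relaxes the low-dimensional semidefinite program. -/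
theorem thetaL2_mono (hγ : 0 ≤ P.gamma2) (hK : 1 ≤ K) {m₁ m₂ : ℕ} (h : m₁ ≤ m₂) (hm₂ : m₂ ≤ K) :
    P.thetaL2 m₁ ≤ P.thetaL2 m₂ := by
  classical
  refine le_sInf ?_
  rintro _ ⟨x, s, L, q, Q, u', u'', B₁, B₂, ⟨hx, hL, hB, hQ, hside⟩, rfl⟩
  let e₀ : Fin m₁ ⊕ Fin (K - m₁) → Fin m₂ ⊕ Fin (K - m₂) := Sum.elim
    (fun i => .inl (Fin.castLE h i)) (fun j => if hj : (j : ℕ) < m₂ - m₁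
      then .inl ⟨m₁ + j, by omega⟩ else .inr ⟨j - (m₂ - m₁), by omega⟩)
  have he₀ : Function.Injective e₀ := by
    rintro (i | i) (j | j) hij <;> simp only [e₀, Sum.elim_inl, Sum.elim_inr] at hij
    · exact congrArg _ (Fin.castLE_injective h (Sum.inl_injective hij))
    · split_ifs at hij
      have := congrArg Fin.val (Sum.inl_injective hij)
      simp only [Fin.val_castLE] at this
      omega
    · split_ifs at hij
      have := congrArg Fin.val (Sum.inl_injective hij)
      simp only [Fin.val_castLE] at this
      omega
    · refine congrArg _ (Fin.ext ?_)
      split_ifs at hij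
      · have := congrArg Fin.val (Sum.inl_injective hij)
        simp only at this
        omega
      · have := congrArg Fin.val (Sum.inr_injective hij)
        simp only at this
        omega
  let e : Fin m₁ ⊕ Fin (K - m₁) ≃ Fin m₂ ⊕ Fin (K - m₂) := Equiv.ofBijective e₀
    ((Fintype.bijective_iff_injective_and_card _).2 ⟨he₀, by
      simp only [Fintype.card_sum, Fintype.card_fin]; omega⟩)
  let M := (fromCols B₁ B₂).submatrix id e
  have hM : Mᵀ * M = 1 := by
    have : Mᵀ * M = ((fromCols B₁ B₂)ᵀ * fromCols B₁ B₂).submatrix e e := rfl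
    rw [this, show (fromCols B₁ B₂)ᵀ * fromCols B₁ B₂ = 1 from hB, submatrix_one_equiv]
  have hsplit : M = fromCols M.toCols₁ M.toCols₂ := (fromCols_toCols M).symm
  let w : Fin K → Fin m₁ ⊕ Fin (K - m₁) → ℝ := fun k => Sum.elim (u' k) (u'' k) ∘ e
  refine (L2Feasible.thetaL2_le (s := s) (q := q) (Q' := Q.submatrix (Fin.castLE h) (Fin.castLE h))
    (u' := fun k i => w k (.inl i)) (u'' := fun k j => w k (.inr j)) (B₁ := M.toCols₁)
    (B₂ := M.toCols₂) ⟨hx, hL, ?_, fun k => ?_, fun k => ?_⟩).trans ?_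
  · rw [Orthonormal₂, ← hsplit, hM]
  · have : bordered (P.corner x s (L k) k) (fun i => w k (.inl i))
        (Q.submatrix (Fin.castLE h) (Fin.castLE h)) =
        (bordered (P.corner x s (L k) k) (u' k) Q).submatrix (Sum.map id (Fin.castLE h))
          (Sum.map id (Fin.castLE h)) := by
      ext (i | i) (j | j) <;> rfl
    rw [this]
    exact (hQ k).submatrix _
  · have h1 : M *ᵥ w k = fromCols B₁ B₂ *ᵥ Sum.elim (u' k) (u'' k) := by
      ext i
      simp only [mulVec, dotProduct, M, submatrix_apply, id, w, Function.comp]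
      exact e.sum_comp fun j => fromCols B₁ B₂ i j * Sum.elim (u' k) (u'' k) j
    rw [hside k]
    have h2 : fromCols B₁ B₂ *ᵥ Sum.elim (u' k) (u'' k) = B₁ *ᵥ u' k + B₂ *ᵥ u'' k := by
      rw [fromCols_mulVec]; rfl
    rw [← h2, ← h1]
    conv_lhs => rw [hsplit, fromCols_mulVec]
    rfl
  · rw [EReal.coe_le_coe_iff]
    have hpsd := bordered_posSemidef_block (hQ ⟨0, hK⟩)
    have : (Q.submatrix (Fin.castLE h) (Fin.castLE h)).trace ≤ Q.trace := by
      simp only [trace, diag_apply, submatrix_apply]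
      rw [← Finset.sum_image (s := Finset.univ) (g := Fin.castLE h) (f := fun i => Q i i)
        (fun _ _ _ _ h' => Fin.castLE_injective h h')]
      exact Finset.sum_le_sum_of_subset_of_nonneg (Finset.subset_univ _)
        fun i _ _ => hpsd.diag_nonneg
    simp only [objective, matInner_one]
    gcongr

end MomentDRO

/-! ### Moments -/

section Moments
variable {m : ℕ} {ι : Type*} [Fintype ι] {ν : Measure (Fin m → ℝ)} {Z : (Fin m → ℝ) → (ι → ℝ)}

theorem dotProduct_mulVec_eq_sum (Q : Matrix ι ι ℝ) (η : ι → ℝ) :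
    η ⬝ᵥ (Q *ᵥ η) = ∑ i, ∑ j, Q i j * (η i * η j) := by
  simp only [dotProduct, mulVec, Finset.mul_sum]
  exact Finset.sum_congr rfl fun i _ => Finset.sum_congr rfl fun j _ => by ring

theorem integrable_form (h : ∀ i j, Integrable (fun ξ => Z ξ i * Z ξ j) ν) (Q : Matrix ι ι ℝ) :
    Integrable (fun ξ => Z ξ ⬝ᵥ (Q *ᵥ Z ξ)) ν := by
  simp only [dotProduct_mulVec_eq_sum]
  exact integrable_finsetSum _ fun i _ => integrable_finsetSum _ fun j _ => (h i j).const_mul _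

theorem integral_form (h : ∀ i j, Integrable (fun ξ => Z ξ i * Z ξ j) ν) (Q : Matrix ι ι ℝ) :
    ∫ ξ, Z ξ ⬝ᵥ (Q *ᵥ Z ξ) ∂ν = (Q * momentMatrix ν Z).trace := by
  have hij : ∀ i j, Integrable (fun ξ => Q i j * (Z ξ i * Z ξ j)) ν :=
    fun i j => (h i j).const_mul (Q i j)
  simp only [dotProduct_mulVec_eq_sum]
  rw [integral_finsetSum _ fun i _ => integrable_finsetSum _ fun j _ => hij i j]
  simp only [trace, diag_apply, mul_apply]
  refine Finset.sum_congr rfl fun i _ => ?_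
  rw [integral_finsetSum _ fun j _ => hij i j]
  refine Finset.sum_congr rfl fun j _ => ?_
  rw [integral_const_mul, momentMatrix, Matrix.of_apply]
  simp only [mul_comm]

theorem sq_dotProduct (η v : ι → ℝ) : (η ⬝ᵥ v) ^ 2 = v ⬝ᵥ (vecMulVec η η *ᵥ v) := by
  rw [dotProduct_mulVec_eq_sum, sq]
  simp only [dotProduct, Finset.sum_mul_sum, vecMulVec_apply]
  exact Finset.sum_congr rfl fun i _ => Finset.sum_congr rfl fun j _ => by ring

theorem integrable_sq (h : ∀ i j, Integrable (fun ξ => Z ξ i * Z ξ j) ν) (η : ι → ℝ) :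
    Integrable (fun ξ => (η ⬝ᵥ Z ξ) ^ 2) ν := by
  simp only [sq_dotProduct]
  exact integrable_form h _

/-- A second-moment bound tested against one-dimensional projections. -/
theorem secondMomentLE_iff {M : Matrix ι ι ℝ} : SecondMomentLE ν Z M ↔
    (∀ i j, Integrable (fun ξ => Z ξ i * Z ξ j) ν) ∧ M.IsSymm ∧
      ∀ η, ∫ ξ, (η ⬝ᵥ Z ξ) ^ 2 ∂ν ≤ η ⬝ᵥ (M *ᵥ η) := by
  rw [SecondMomentLE]
  refine and_congr_right fun h => ?_
  have hs : (momentMatrix ν Z).IsSymm := by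
    ext i j
    simp [momentMatrix, mul_comm]
  have hform : ∀ η, η ⬝ᵥ (momentMatrix ν Z *ᵥ η) = ∫ ξ, (η ⬝ᵥ Z ξ) ^ 2 ∂ν := fun η => by
    simp only [sq_dotProduct]
    rw [integral_form h, dotProduct_mulVec_eq_sum, trace_mul_comm]
    simp [trace, mul_apply, vecMulVec_apply, mul_comm]
  rw [posSemidef_iff_real]
  refine and_congr ⟨fun h => ?_, fun h => h.sub hs⟩ (forall_congr' fun η => ?_)
  · simpa using h.add hs
  · rw [sub_mulVec, dotProduct_sub, hform, sub_nonneg]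

theorem SecondMomentLE.ae_eq_zero (h : SecondMomentLE ν Z 0) : ∀ᵐ ξ ∂ν, Z ξ = 0 := by
  classical
  have h' := secondMomentLE_iff.1 h
  have : ∀ i, ∀ᵐ ξ ∂ν, Z ξ i = 0 := fun i => by
    have h1 := h'.2.2 (Pi.single i 1)
    have h2 := integrable_sq h'.1 (Pi.single i 1)
    simp only [single_one_dotProduct, zero_mulVec, dotProduct_zero] at h1 h2
    have h3 := (integral_eq_zero_iff_of_nonneg (fun ξ => sq_nonneg _) h2).1
      (le_antisymm h1 (integral_nonneg fun ξ => sq_nonneg _))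
    filter_upwards [h3] with ξ hξ
    simpa using hξ
  filter_upwards [ae_all_iff.2 this] with ξ hξ
  exact funext hξ

theorem integrable_dotProduct (h : ∀ i, Integrable (fun ξ : Fin m → ℝ => ξ i) ν)
    (c : Fin m → ℝ) : Integrable (fun ξ => c ⬝ᵥ ξ) ν := by
  simp only [dotProduct]
  exact integrable_finsetSum _ fun i _ => (h i).const_mul _

theorem integral_dotProduct (h : ∀ i, Integrable (fun ξ : Fin m → ℝ => ξ i) ν)
    (c : Fin m → ℝ) : ∫ ξ, c ⬝ᵥ ξ ∂ν = c ⬝ᵥ meanVec ν := by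
  simp only [dotProduct]
  rw [integral_finsetSum _ fun i _ => (h i).const_mul _]
  exact Finset.sum_congr rfl fun i _ => integral_const_mul _ _

theorem sq_dotProduct_meanVec_le [IsProbabilityMeasure ν]
    (h : ∀ i, Integrable (fun ξ : Fin m → ℝ => ξ i) ν) (c : Fin m → ℝ)
    (hc : Integrable (fun ξ => (c ⬝ᵥ ξ) ^ 2) ν) :
    (c ⬝ᵥ meanVec ν) ^ 2 ≤ ∫ ξ, (c ⬝ᵥ ξ) ^ 2 ∂ν := by
  set a := c ⬝ᵥ meanVec ν
  have h1 := integrable_dotProduct h c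
  have h0 : 0 ≤ ∫ ξ, ((c ⬝ᵥ ξ) ^ 2 - 2 * a * (c ⬝ᵥ ξ) + a ^ 2) ∂ν :=
    integral_nonneg fun ξ => by
      have := sq_nonneg (c ⬝ᵥ ξ - a)
      simp only [Pi.zero_apply]
      linarith
  have h2 : Integrable (fun ξ => (c ⬝ᵥ ξ) ^ 2 - 2 * a * (c ⬝ᵥ ξ)) ν := hc.sub (h1.const_mul _)
  rw [integral_add h2 (integrable_const _), integral_sub hc (h1.const_mul _), integral_const_mul, integral_dotProduct h] at h0
  simp only [integral_const, probReal_univ, one_smul] at h0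
  change 0 ≤ _ - 2 * a * a + a ^ 2 at h0
  linarith

end Moments

namespace MomentDRO

variable {n m l K : ℕ} (P : MomentDRO n m l K)

/-! ### The objective and the support -/

theorem mem_SI_iff {ξ : Fin m → ℝ} : ξ ∈ P.SI ↔ P.A *ᵥ (P.W *ᵥ ξ + P.mu) ≤ P.b := Iff.rfl

theorem isClosed_SI : IsClosed P.SI := by
  refine isClosed_le (f := fun ξ : Fin m → ℝ => P.A *ᵥ (P.W *ᵥ ξ + P.mu)) ?_ continuous_const
  exact Continuous.matrix_mulVec continuous_const
    ((Continuous.matrix_mulVec continuous_const continuous_id).add continuous_const)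

theorem le_f (x : Fin n → ℝ) (ξ : Fin m → ℝ) (k : Fin K) :
    P.y0 k x + P.y k x ⬝ᵥ ξ ≤ P.f x ξ :=
  le_ciSup (f := fun k => P.y0 k x + P.y k x ⬝ᵥ ξ) (Set.finite_range _).bddAbove k

theorem dotProduct_W (c ξ : Fin m → ℝ) :
    c ⬝ᵥ (P.W *ᵥ ξ + P.mu) = (P.Wᵀ *ᵥ c) ⬝ᵥ ξ + c ⬝ᵥ P.mu := by
  rw [dotProduct_add, dotProduct_mulVec, mulVec_transpose]

variable {P} in
theorem SupportMean.integrable_f {ν : Measure (Fin m → ℝ)} (h : P.SupportMean ν)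
    (hK : 1 ≤ K) (x : Fin n → ℝ) : Integrable (fun ξ => P.f x (P.W *ᵥ ξ + P.mu)) ν := by
  have := h.1
  have : Nonempty (Fin K) := ⟨⟨0, hK⟩⟩
  let g : Fin K → (Fin m → ℝ) → ℝ := fun k ξ => P.y0 k x + P.y k x ⬝ᵥ (P.W *ᵥ ξ + P.mu)
  have hg : ∀ k, Integrable (g k) ν := fun k => by
    simp only [g, dotProduct_W]
    exact (integrable_const _).add ((integrable_dotProduct h.2.2.1 _).add (integrable_const _))
  have hf : (fun ξ => P.f x (P.W *ᵥ ξ + P.mu)) =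
      fun ξ => Finset.univ.sup' Finset.univ_nonempty fun k => g k ξ := by
    ext ξ
    rw [Finset.sup'_univ_eq_ciSup]
    rfl
  have hcont : Continuous fun ξ => P.f x (P.W *ᵥ ξ + P.mu) := by
    rw [hf]
    refine Continuous.finset_sup'_apply _ fun k _ => ?_
    exact continuous_const.add (Continuous.dotProduct continuous_const
      ((Continuous.matrix_mulVec continuous_const continuous_id).add continuous_const))
  refine (integrable_finsetSum Finset.univ fun k _ => (hg k).abs).mono'
    hcont.aestronglyMeasurable (Filter.Eventually.of_forall fun ξ => ?_)
  have hle : ∀ k, |g k ξ| ≤ ∑ k, |g k ξ| := fun k =>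
    Finset.single_le_sum (f := fun k => |g k ξ|) (fun _ _ => abs_nonneg _) (Finset.mem_univ k)
  rw [Real.norm_eq_abs, abs_le]
  constructor
  · exact (neg_le_neg (hle ⟨0, hK⟩)).trans ((neg_abs_le _).trans (P.le_f x _ ⟨0, hK⟩))
  · exact ciSup_le fun k => (le_abs_self _).trans (hle k)

variable {P} in
theorem SupportMean.meanVec_mem {ν : Measure (Fin m → ℝ)} (h : P.SupportMean ν) :
    meanVec ν ∈ P.SI := by
  have := h.1
  have hae : ∀ᵐ ξ ∂ν, ξ ∈ P.SI :=
    (mem_ae_iff_prob_eq_one P.isClosed_SI.measurableSet).2 h.2.1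
  rw [mem_SI_iff]
  intro i
  have hi : ∀ ξ : Fin m → ℝ, (P.A *ᵥ (P.W *ᵥ ξ + P.mu)) i =
      (P.Wᵀ *ᵥ P.A i) ⬝ᵥ ξ + P.A i ⬝ᵥ P.mu := fun ξ => P.dotProduct_W _ _
  rw [hi, ← integral_dotProduct h.2.2.1]
  have hint := integrable_dotProduct h.2.2.1 (P.Wᵀ *ᵥ P.A i)
  have h1 : ∫ ξ, ((P.Wᵀ *ᵥ P.A i) ⬝ᵥ ξ + P.A i ⬝ᵥ P.mu) ∂ν ≤ ∫ _, P.b i ∂ν := by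
    refine integral_mono_ae (hint.add (integrable_const _)) (integrable_const _) ?_
    filter_upwards [hae] with ξ hξ
    rw [← hi]
    exact hξ i
  rw [integral_add hint (integrable_const _)] at h1
  simpa using h1

/-! ### Weak duality -/

/-- The constraints of the low-dimensional semidefinite program for a fixed system `[B₁, B₂]` with
any numbers of columns and a fixed decision. For `B₁ = 1` and an empty `B₂` they are those of the
semidefinite formulation of the original problem. -/
structure DualFeasible {m₁ m₂ : ℕ} (B₁ : Matrix (Fin m) (Fin m₁) ℝ)
    (B₂ : Matrix (Fin m) (Fin m₂) ℝ) (x : Fin n → ℝ) (s : ℝ) (L : Fin K → Fin l → ℝ)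
    (q : Fin m → ℝ) (Q : Matrix (Fin m₁) (Fin m₁) ℝ) (u' : Fin K → Fin m₁ → ℝ)
    (u'' : Fin K → Fin m₂ → ℝ) : Prop where
  nonneg : ∀ k, 0 ≤ L k
  posSemidef : ∀ k, (bordered (P.corner x s (L k) k) (u' k) Q).PosSemidef
  side_eq : ∀ k, P.side x (L k) q k = B₁ *ᵥ u' k + B₂ *ᵥ u'' k

section duality
variable {P} {m₁ m₂ : ℕ} {B₁ : Matrix (Fin m) (Fin m₁) ℝ} {B₂ : Matrix (Fin m) (Fin m₂) ℝ}
  {x : Fin n → ℝ}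

/-- On the support, a feasible point of the semidefinite program gives a quadratic majorant of the
objective. -/
theorem DualFeasible.f_le {s : ℝ} {L : Fin K → Fin l → ℝ} {q : Fin m → ℝ}
    {Q : Matrix (Fin m₁) (Fin m₁) ℝ} {u' : Fin K → Fin m₁ → ℝ} {u'' : Fin K → Fin m₂ → ℝ}
    (h : P.DualFeasible B₁ B₂ x s L q Q u' u'') (hK : 1 ≤ K) {ξ : Fin m → ℝ} (hξ : ξ ∈ P.SI)
    (hB₂ : B₂ᵀ *ᵥ ξ = 0) : P.f x (P.W *ᵥ ξ + P.mu) ≤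
      s + q ⬝ᵥ ξ + (B₁ᵀ *ᵥ ξ) ⬝ᵥ (Q *ᵥ (B₁ᵀ *ᵥ ξ)) := by
  have : Nonempty (Fin K) := ⟨⟨0, hK⟩⟩
  refine ciSup_le fun k => ?_
  have h1 := (bordered_posSemidef_iff.1 (h.posSemidef k)).2 1 (B₁ᵀ *ᵥ ξ)
  have h2 : P.side x (L k) q k ⬝ᵥ ξ = u' k ⬝ᵥ (B₁ᵀ *ᵥ ξ) := by
    rw [h.side_eq k, add_dotProduct, ← vecMul_transpose, ← vecMul_transpose,
      ← dotProduct_mulVec, ← dotProduct_mulVec, hB₂, dotProduct_zero, add_zero]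
  have h3 : L k ⬝ᵥ (P.A *ᵥ (P.W *ᵥ ξ + P.mu)) ≤ L k ⬝ᵥ P.b :=
    dotProduct_le_dotProduct_of_nonneg_left hξ (h.nonneg k)
  have h4 : L k ⬝ᵥ (P.A *ᵥ (P.W *ᵥ ξ + P.mu)) =
      (P.Wᵀ *ᵥ (P.Aᵀ *ᵥ L k)) ⬝ᵥ ξ + L k ⬝ᵥ (P.A *ᵥ P.mu) := by
    rw [dotProduct_mulVec, ← mulVec_transpose, dotProduct_W, mulVec_transpose P.A,
      ← dotProduct_mulVec]
  rw [h4] at h3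
  rw [dotProduct_W]
  simp only [side, mulVec_sub, add_dotProduct, sub_dotProduct] at h2
  simp only [borderedForm, corner] at h1
  linarith

theorem DualFeasible.integral_f_le {s : ℝ} {L : Fin K → Fin l → ℝ} {q : Fin m → ℝ}
    {Q : Matrix (Fin m₁) (Fin m₁) ℝ} {u' : Fin K → Fin m₁ → ℝ} {u'' : Fin K → Fin m₂ → ℝ}
    (h : P.DualFeasible B₁ B₂ x s L q Q u' u'') (hK : 1 ≤ K) {ν : Measure (Fin m → ℝ)}
    (hν : ν ∈ P.DL2 B₁ B₂) :
    ∫ ξ, P.f x (P.W *ᵥ ξ + P.mu) ∂ν ≤ P.objective s q Q := by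
  obtain ⟨hS, h₁, h₂⟩ := hν
  have := hS.1
  have hint := integrable_dotProduct hS.2.2.1 q
  have hform := integrable_form h₁.1 Q
  have h1 : ∫ ξ, P.f x (P.W *ᵥ ξ + P.mu) ∂ν ≤
      ∫ ξ, (s + q ⬝ᵥ ξ + (B₁ᵀ *ᵥ ξ) ⬝ᵥ (Q *ᵥ (B₁ᵀ *ᵥ ξ))) ∂ν := by
    refine integral_mono_ae (hS.integrable_f hK x) (((integrable_const _).add hint).add hform) ?_
    filter_upwards [(mem_ae_iff_prob_eq_one P.isClosed_SI.measurableSet).2 hS.2.1,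
      h₂.ae_eq_zero] with ξ hξ hξ₂
    exact h.f_le hK hξ hξ₂
  have hlin : Integrable (fun ξ => s + q ⬝ᵥ ξ) ν := (integrable_const _).add hint
  rw [integral_add hlin hform,
    integral_add (integrable_const _) hint, integral_dotProduct hS.2.2.1,
    integral_form h₁.1] at h1
  have h2 := trace_mul_nonneg_of_posSemidef
    (bordered_posSemidef_block (h.posSemidef ⟨0, hK⟩)) h₁.2
  rw [Matrix.mul_sub, trace_sub, mul_smul_comm, Matrix.mul_one, trace_smul, smul_eq_mul] at h2
  have h3 := dotProduct_le_l2norm_mul q (meanVec ν)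
  have h4 := mul_le_mul_of_nonneg_left (l2norm_le_sqrt hS.2.2.2) (l2norm_nonneg q)
  simp only [integral_const, probReal_univ, one_smul] at h1
  simp only [objective, matInner_one]
  linarith

theorem DualFeasible.worstCase_le {s : ℝ} {L : Fin K → Fin l → ℝ} {q : Fin m → ℝ}
    {Q : Matrix (Fin m₁) (Fin m₁) ℝ} {u' : Fin K → Fin m₁ → ℝ} {u'' : Fin K → Fin m₂ → ℝ}
    (h : P.DualFeasible B₁ B₂ x s L q Q u' u'') (hK : 1 ≤ K) :
    P.worstCase (P.DL2 B₁ B₂) x ≤ ((P.objective s q Q : ℝ) : EReal) :=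
  iSup₂_le fun _ hν => EReal.coe_le_coe_iff.2 (h.integral_f_le hK hν)

/-! ### Finitely supported distributions -/

/-- The distribution with finitely many atoms `p k` of masses `w k`. -/
noncomputable def atomic {ι : Type*} [Fintype ι] (w : ι → ℝ) (p : ι → Fin m → ℝ) : Measure (Fin m → ℝ) :=
  ∑ k, ENNReal.ofReal (w k) • Measure.dirac (p k)

theorem integrable_atomic {ι : Type*} [Fintype ι] (w : ι → ℝ) (p : ι → Fin m → ℝ)
    (g : (Fin m → ℝ) → ℝ) : Integrable g (atomic w p) :=
  integrable_finsetSum_measure.2 fun _ _ =>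
    (integrable_dirac (by simp)).smul_measure ENNReal.ofReal_ne_top

theorem integral_atomic {ι : Type*} [Fintype ι] {w : ι → ℝ} (hw : ∀ k, 0 ≤ w k)
    (p : ι → Fin m → ℝ) (g : (Fin m → ℝ) → ℝ) : ∫ ξ, g ξ ∂(atomic w p) = ∑ k, w k * g (p k) := by
  rw [atomic, integral_finsetSum_measure fun _ _ =>
    (integrable_dirac (by simp)).smul_measure ENNReal.ofReal_ne_top]
  refine Finset.sum_congr rfl fun k _ => ?_
  rw [integral_smul_measure, integral_dirac, ENNReal.toReal_ofReal (hw k), smul_eq_mul]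

theorem atomic_mem_DL2 {ι : Type*} [Fintype ι] {w : ι → ℝ} (hw : ∀ k, 0 ≤ w k)
    (hw1 : ∑ k, w k = 1) {p : ι → Fin m → ℝ} (hp : ∀ k, p k ∈ P.SI)
    (hB₂ : ∀ k, B₂ᵀ *ᵥ p k = 0)
    (hmean : (∑ k, w k • p k) ⬝ᵥ (∑ k, w k • p k) ≤ P.gamma1)
    (hB₁ : ∀ η, ∑ k, w k * (η ⬝ᵥ (B₁ᵀ *ᵥ p k)) ^ 2 ≤ P.gamma2 * (η ⬝ᵥ η)) :
    atomic w p ∈ P.DL2 B₁ B₂ := by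
  have hmv : meanVec (atomic w p) = ∑ k, w k • p k := by
    ext i
    rw [meanVec, integral_atomic hw]
    simp
  have hmass : ∀ s : Set (Fin m → ℝ), (∀ k, p k ∈ s) → atomic w p s = 1 := fun s hs => by
    simp only [atomic, Measure.coe_finsetSum, Finset.sum_apply, Measure.smul_apply, smul_eq_mul]
    rw [Finset.sum_congr rfl fun k _ => by rw [Measure.dirac_apply_of_mem (hs k), mul_one],
      ← ENNReal.ofReal_sum_of_nonneg fun k _ => hw k, hw1, ENNReal.ofReal_one]
  refine ⟨⟨⟨hmass _ fun _ => Set.mem_univ _⟩, hmass _ hp, fun i => integrable_atomic _ _ _, ?_⟩,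
    secondMomentLE_iff.2 ⟨fun i j => integrable_atomic _ _ _, ?_, fun η => ?_⟩,
    secondMomentLE_iff.2 ⟨fun i j => integrable_atomic _ _ _, ?_, fun η => ?_⟩⟩
  · rwa [hmv]
  · simp [IsSymm]
  · rw [integral_atomic hw, smul_mulVec, one_mulVec, dotProduct_smul, smul_eq_mul]
    exact hB₁ η
  · simp [IsSymm]
  · rw [integral_atomic hw]
    simp [hB₂]

theorem le_integral_f_atomic {w : Fin K → ℝ} (hw : ∀ k, 0 ≤ w k) (p : Fin K → Fin m → ℝ) :
    ∑ k, w k * (P.y0 k x + P.y k x ⬝ᵥ (P.W *ᵥ p k + P.mu)) ≤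
      ∫ ξ, P.f x (P.W *ᵥ ξ + P.mu) ∂(atomic w p) := by
  rw [integral_atomic hw]
  exact Finset.sum_le_sum fun k _ => mul_le_mul_of_nonneg_left (P.le_f x _ k) (hw k)

end duality
end MomentDRO

/-! ### Conic separation -/

theorem LinearMap.nonpos_of_forall_pos_add_smul {V : Type*} [AddCommGroup V] [Module ℝ V]
    (f : V →ₗ[ℝ] ℝ) {e e₀ : V} (h : ∀ ε : ℝ, 0 < ε → f (e + ε • e₀) ≤ 0) : f e ≤ 0 := by
  by_contra! hpos
  have hd : 0 < |f e₀| + 1 := by positivity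
  have h1 := h (f e / (|f e₀| + 1)) (by positivity)
  set ε := f e / (|f e₀| + 1)
  have hε : 0 < ε := by positivity
  have h2 : ε * (|f e₀| + 1) = f e := div_mul_cancel₀ _ hd.ne'
  have h3 := mul_le_mul_of_nonneg_left (neg_abs_le (f e₀)) hε.le
  rw [map_add, map_smul, smul_eq_mul] at h1
  linarith

section form
variable {ι : Type*} [Fintype ι]

theorem borderedForm_add (a b : ℝ) (u v : ι → ℝ) (Q R : Matrix ι ι ℝ) (t : ℝ) (η : ι → ℝ) :
    borderedForm (a + b) (u + v) (Q + R) t η = borderedForm a u Q t η + borderedForm b v R t η := by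
  simp only [borderedForm, add_dotProduct, add_mulVec, dotProduct_add]
  ring

theorem borderedForm_smul (c a : ℝ) (u : ι → ℝ) (Q : Matrix ι ι ℝ) (t : ℝ) (η : ι → ℝ) :
    borderedForm (c * a) (c • u) (c • Q) t η = c * borderedForm a u Q t η := by
  simp only [borderedForm, smul_dotProduct, smul_mulVec, dotProduct_smul, smul_eq_mul]
  ring

theorem borderedForm_smul_arg (c a : ℝ) (u : ι → ℝ) (Q : Matrix ι ι ℝ) (t : ℝ) (η : ι → ℝ) :
    borderedForm a u Q (c * t) (c • η) = c ^ 2 * borderedForm a u Q t η := by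
  simp only [borderedForm, mulVec_smul, smul_dotProduct, dotProduct_smul, smul_eq_mul]
  ring

theorem borderedForm_one_pos [DecidableEq ι] {a : ℝ} {u : ι → ℝ} (h : 1 + u ⬝ᵥ u ≤ a) {t : ℝ}
    {η : ι → ℝ} (h0 : (t, η) ≠ 0) : 0 < borderedForm a u 1 t η := by
  refine lt_of_lt_of_le ?_ (borderedForm_one_le t η)
  have h1 : t ^ 2 ≤ (a - u ⬝ᵥ u) * t ^ 2 := le_mul_of_one_le_left (sq_nonneg t) (by linarith)
  have h2 := real_dotProduct_self_nonneg η
  by_cases ht : t = 0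
  · have hη : η ≠ 0 := fun hη => h0 (by rw [ht, hη]; rfl)
    have h3 : η ⬝ᵥ η ≠ 0 := fun h => hη (dotProduct_self_eq_zero.1 h)
    have h4 : 0 < η ⬝ᵥ η := lt_of_le_of_ne h2 h3.symm
    linarith [sq_nonneg t]
  · have : 0 < t ^ 2 := by positivity
    linarith

theorem isOpen_borderedForm_pos : IsOpen {N : ℝ × (ι → ℝ) × Matrix ι ι ℝ |
    ∀ t η, (t, η) ≠ 0 → 0 < borderedForm N.1 N.2.1 N.2.2 t η} := by
  have hset : {N : ℝ × (ι → ℝ) × Matrix ι ι ℝ |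
      ∀ t η, (t, η) ≠ 0 → 0 < borderedForm N.1 N.2.1 N.2.2 t η} =
      {N | ∀ z ∈ Metric.sphere (0 : ℝ × (ι → ℝ)) 1,
        0 < borderedForm N.1 N.2.1 N.2.2 z.1 z.2} := by
    ext N
    refine ⟨fun h z hz => h z.1 z.2 ?_, fun h t η h0 => ?_⟩
    · exact ne_zero_of_mem_sphere one_ne_zero ⟨z, hz⟩
    · have hn : 0 < ‖(t, η)‖ := norm_pos_iff.2 h0
      have := h (‖(t, η)‖⁻¹ • (t, η)) (by
        rw [mem_sphere_zero_iff_norm, norm_smul, norm_inv, norm_norm, inv_mul_cancel₀ hn.ne'])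
      simp only [Prod.smul_mk, smul_eq_mul] at this
      rw [borderedForm_smul_arg] at this
      exact pos_of_mul_pos_right this (by positivity)
  rw [hset, isOpen_iff_eventually]
  intro N hN
  refine (isCompact_sphere _ _).eventually_forall_of_forall_eventually fun z hz => ?_
  refine ContinuousAt.eventually_lt continuousAt_const ?_ (hN z hz)
  refine Continuous.continuousAt ?_
  simp only [borderedForm]
  have h1 : Continuous fun p : (ℝ × (ι → ℝ) × Matrix ι ι ℝ) × (ℝ × (ι → ℝ)) => p.2.2 := by fun_prop
  have h2 : Continuous fun p : (ℝ × (ι → ℝ) × Matrix ι ι ℝ) × (ℝ × (ι → ℝ)) => p.1.2.1 := by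
    fun_prop
  have h3 : Continuous fun p : (ℝ × (ι → ℝ) × Matrix ι ι ℝ) × (ℝ × (ι → ℝ)) => p.1.2.2 := by
    fun_prop
  exact (by fun_prop : Continuous fun p : (ℝ × (ι → ℝ) × Matrix ι ι ℝ) × (ℝ × (ι → ℝ)) =>
    p.1.1 * p.2.1 ^ 2).add ((by fun_prop : Continuous fun p : (ℝ × (ι → ℝ) × Matrix ι ι ℝ) ×
    (ℝ × (ι → ℝ)) => p.2.1).mul (h2.dotProduct h1)) |>.add (h1.dotProduct (h3.matrix_mulVec h1))

end form

namespace MomentDRO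

variable {n m l K : ℕ} {P : MomentDRO n m l K} {m₁ m₂ : ℕ} {B₁ : Matrix (Fin m) (Fin m₁) ℝ}
  {B₂ : Matrix (Fin m) (Fin m₂) ℝ} {x : Fin n → ℝ}

theorem corner_eq_add (s : ℝ) (Lk : Fin l → ℝ) (k : Fin K) :
    P.corner x s Lk k = s + P.corner x 0 Lk k := by
  simp only [corner]
  ring

theorem corner_convex {a b : ℝ} (hab : a + b = 1) (s s' : ℝ) (Lk Lk' : Fin l → ℝ) (k : Fin K) :
    P.corner x (a * s + b * s') (a • Lk + b • Lk') k =
      a * P.corner x s Lk k + b * P.corner x s' Lk' k := by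
  obtain rfl : b = 1 - a := by linarith
  simp only [corner, add_dotProduct, smul_dotProduct, smul_eq_mul]
  ring

theorem side_convex {a b : ℝ} (hab : a + b = 1) (q q' : Fin m → ℝ) (Lk Lk' : Fin l → ℝ)
    (k : Fin K) : P.side x (a • Lk + b • Lk') (a • q + b • q') k =
      a • P.side x Lk q k + b • P.side x Lk' q' k := by
  obtain rfl : b = 1 - a := by linarith
  simp only [side, mulVec_sub, mulVec_add, mulVec_smul]
  ext i
  simp only [Pi.add_apply, Pi.smul_apply, Pi.sub_apply, smul_eq_mul]
  ring

/-- The equations `h_k = B₁ u'_k + B₂ u''_k` together with the sign constraints on the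
multipliers: the polyhedral part of the semidefinite program. -/
def LinFeasible (P : MomentDRO n m l K) (B₁ : Matrix (Fin m) (Fin m₁) ℝ)
    (B₂ : Matrix (Fin m) (Fin m₂) ℝ) (x : Fin n → ℝ) (L : Fin K → Fin l → ℝ) (q : Fin m → ℝ)
    (u' : Fin K → Fin m₁ → ℝ) (u'' : Fin K → Fin m₂ → ℝ) : Prop :=
  (∀ k, 0 ≤ L k) ∧ ∀ k, P.side x (L k) q k = B₁ *ᵥ u' k + B₂ *ᵥ u'' k

/-- For every point of the polyhedral part there is a value of `s` which makes the bordered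
matrices with lower right block `1` positive definite. -/
theorem exists_slater (L : Fin K → Fin l → ℝ) (u' : Fin K → Fin m₁ → ℝ) :
    ∃ s, ∀ k, 1 + u' k ⬝ᵥ u' k ≤ P.corner x s (L k) k := by
  refine ⟨1 + ∑ k, (|P.corner x 0 (L k) k| + u' k ⬝ᵥ u' k), fun k => ?_⟩
  have h := Finset.single_le_sum (f := fun k => |P.corner x 0 (L k) k| + u' k ⬝ᵥ u' k)
    (fun k _ => add_nonneg (abs_nonneg _) (real_dotProduct_self_nonneg _)) (Finset.mem_univ k)
  rw [corner_eq_add]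
  have := neg_abs_le (P.corner x 0 (L k) k)
  linarith

/-- The data `(a, u, Q)` of a bordered matrix. -/
abbrev BorderedTriple (m₁ : ℕ) := ℝ × (Fin m₁ → ℝ) × Matrix (Fin m₁) (Fin m₁) ℝ

/-- The space in which the semidefinite program is separated from the cone of strictly feasible
values: a bound for the norm term, the `K` bordered matrices and the argument of the norm. -/
abbrev ConicSpace (K m m₁ : ℕ) := ℝ × (Fin K → BorderedTriple m₁) × (Fin m → ℝ)

/-- Lagrange multipliers for the semidefinite constraints of the program with fixed `B₁`, `B₂` and
`x`. The functional `S ↦ w k * S`, `u ↦ a k u`, `Q ↦ Y k Q` is the multiplier of the `k`-th bordered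
matrix and `π` is a subgradient of the norm term. -/
theorem exists_multipliers {v : ℝ} {L₀ : Fin K → Fin l → ℝ} {q₀ : Fin m → ℝ}
    {u'₀ : Fin K → Fin m₁ → ℝ} {u''₀ : Fin K → Fin m₂ → ℝ}
    (hlin : P.LinFeasible B₁ B₂ x L₀ q₀ u'₀ u''₀)
    (hv : ∀ s L q Q u' u'', P.DualFeasible B₁ B₂ x s L q Q u' u'' → v ≤ P.objective s q Q) :
    ∃ (w : Fin K → ℝ) (a : Fin K → (Fin m₁ → ℝ) →ₗ[ℝ] ℝ)
      (Y : Fin K → Matrix (Fin m₁) (Fin m₁) ℝ →ₗ[ℝ] ℝ) (π : (Fin m → ℝ) →ₗ[ℝ] ℝ),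
      (∀ k t η, 0 ≤ w k * t ^ 2 + 2 * t * a k η + Y k (vecMulVec η η)) ∧
      (∀ q, 0 ≤ √P.gamma1 * l2norm q + π q) ∧
      ∀ s L q Q u' u'', Q.IsSymm → P.LinFeasible B₁ B₂ x L q u' u'' →
        v - s - P.gamma2 * Q.trace + ∑ k, (w k * P.corner x s (L k) k + a k (u' k) + Y k Q) + π q
          ≤ 0 := by
  classical
  let C : Set (ConicSpace K m m₁) := {e | √P.gamma1 * l2norm e.2.2 < e.1 ∧
    ∀ k t η, (t, η) ≠ 0 → 0 < borderedForm (e.2.1 k).1 (e.2.1 k).2.1 (e.2.1 k).2.2 t η}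
  let T : Set (ConicSpace K m m₁) := {e | ∃ s L q Q u' u'', Q.IsSymm ∧ P.LinFeasible B₁ B₂ x L q u' u'' ∧
    e = (v - s - P.gamma2 * Q.trace, fun k => (P.corner x s (L k) k, u' k, Q), q)}
  have hCadd : ∀ e ∈ C, ∀ e' ∈ C, e + e' ∈ C := by
    intro e he e' he'
    refine ⟨?_, fun k t η h0 => ?_⟩
    · have h1 := mul_le_mul_of_nonneg_left (l2norm_add_le e.2.2 e'.2.2) (Real.sqrt_nonneg P.gamma1)
      have h2 := he.1
      have h3 := he'.1
      simp only [Prod.fst_add, Prod.snd_add]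
      linarith
    · simp only [Prod.fst_add, Prod.snd_add, Pi.add_apply, borderedForm_add]
      exact add_pos (he.2 k t η h0) (he'.2 k t η h0)
  have hCsmul : ∀ c : ℝ, 0 < c → ∀ e ∈ C, c • e ∈ C := by
    intro c hc e he
    refine ⟨?_, fun k t η h0 => ?_⟩
    · have h1 := mul_lt_mul_of_pos_left he.1 hc
      simp only [Prod.smul_fst, Prod.smul_snd, smul_eq_mul, l2norm_smul hc.le]
      linarith
    · simp only [Prod.smul_fst, Prod.smul_snd, Pi.smul_apply, smul_eq_mul, borderedForm_smul]
      exact mul_pos hc (he.2 k t η h0)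
  have hCconv : Convex ℝ C := by
    refine convex_iff_forall_pos.2 fun e he e' he' a b ha hb _ => ?_
    exact hCadd _ (hCsmul a ha e he) _ (hCsmul b hb e' he')
  have hCopen : IsOpen C := by
    refine IsOpen.inter ?_ ?_
    · exact isOpen_lt (continuous_const.mul (continuous_l2norm.comp
        (continuous_snd.comp continuous_snd))) continuous_fst
    · have : {e : ConicSpace K m m₁ | ∀ k t η, (t, η) ≠ 0 →
          0 < borderedForm (e.2.1 k).1 (e.2.1 k).2.1 (e.2.1 k).2.2 t η} =
          ⋂ k, (fun e : ConicSpace K m m₁ => e.2.1 k) ⁻¹' {N | ∀ t η, (t, η) ≠ 0 →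
            0 < borderedForm N.1 N.2.1 N.2.2 t η} := by
        ext e
        simp only [Set.mem_iInter]
        rfl
      change IsOpen {e : ConicSpace K m m₁ | ∀ k t η, (t, η) ≠ 0 →
          0 < borderedForm (e.2.1 k).1 (e.2.1 k).2.1 (e.2.1 k).2.2 t η}
      rw [this]
      exact isOpen_iInter_of_finite fun k => isOpen_borderedForm_pos.preimage
        ((continuous_apply k).comp (continuous_fst.comp continuous_snd))
  have hTconv : Convex ℝ T := by
    rintro _ ⟨s, L, q, Q, u', u'', hQ, hl, rfl⟩ _ ⟨s', L', q', Q', v', v'', hQ', hl', rfl⟩ a b ha hb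
      hab
    refine ⟨a * s + b * s', fun k => a • L k + b • L' k, a • q + b • q', a • Q + b • Q',
      fun k => a • u' k + b • v' k, fun k => a • u'' k + b • v'' k,
      (hQ.smul a).add (hQ'.smul b), ⟨fun k => ?_, fun k => ?_⟩, ?_⟩
    · exact add_nonneg (smul_nonneg ha (hl.1 k)) (smul_nonneg hb (hl'.1 k))
    · rw [side_convex hab, hl.2 k, hl'.2 k]
      simp only [mulVec_add, mulVec_smul, smul_add]
      abel
    · refine Prod.ext ?_ (Prod.ext (funext fun k => ?_) rfl)
      · obtain rfl : b = 1 - a := by linarith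
        simp only [Prod.smul_mk, Prod.mk_add_mk, smul_eq_mul, trace_add, trace_smul]
        ring
      · simp only [Prod.smul_mk, Prod.mk_add_mk, Pi.add_apply, Pi.smul_apply, smul_eq_mul,
          corner_convex hab]
  have hdisj : Disjoint C T := by
    rw [Set.disjoint_left]
    rintro _ hC ⟨s, L, q, Q, u', u'', hQ, hl, rfl⟩
    have hfeas : P.DualFeasible B₁ B₂ x s L q Q u' u'' := ⟨hl.1, fun k => by
      refine bordered_posSemidef_iff.2 ⟨hQ, fun t η => ?_⟩
      by_cases h0 : (t, η) = 0
      · obtain ⟨rfl, rfl⟩ := Prod.mk_eq_zero.1 h0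
        simp [borderedForm]
      · exact (hC.2 k t η h0).le, hl.2⟩
    have h1 := hv _ _ _ _ _ _ hfeas
    have h2 := hC.1
    simp only [objective, matInner_one] at h1
    simp only at h2
    linarith
  obtain ⟨f, c, hfC, hfT⟩ := geometric_hahn_banach_open hCconv hCopen hTconv hdisj
  -- A point of the cone `C` used to perturb points of its closure.
  let e₀ : ConicSpace K m m₁ := (1, fun _ => (1, 0, 1), 0)
  have he₀ : e₀ ∈ C := ⟨by simp [e₀, l2norm_zero], fun k t η h0 =>
    borderedForm_one_pos (a := 1) (u := 0) (by simp) h0⟩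
  have hC0 : ∀ e ∈ C, f e ≤ 0 := by
    intro e he
    by_contra! hpos
    have := hfC _ (hCsmul ((|c| + 1) / f e) (by positivity) e he)
    rw [map_smul, smul_eq_mul, div_mul_cancel₀ _ hpos.ne'] at this
    linarith [le_abs_self c]
  have hc0 : 0 ≤ c := by
    by_contra! hneg
    have hf := hfC e₀ he₀
    have hf0 : f e₀ < 0 := hf.trans hneg
    have := hfC _ (hCsmul (c / f e₀) (div_pos_of_neg_of_neg hneg hf0) e₀ he₀)
    rw [map_smul, smul_eq_mul, div_mul_cancel₀ _ hf0.ne] at this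
    exact lt_irrefl _ this
  -- The Slater point makes the multiplier of the objective nonzero.
  have hτ : f ((1, 0, 0) : ConicSpace K m m₁) < 0 := by
    obtain ⟨s, hs⟩ := exists_slater (P := P) (x := x) L₀ u'₀
    let r₀ : ℝ := v - s - P.gamma2 * (1 : Matrix (Fin m₁) (Fin m₁) ℝ).trace
    let M : Fin K → BorderedTriple m₁ := fun k => (P.corner x s (L₀ k) k, u'₀ k, 1)
    have h1 : c ≤ f ((r₀, M, q₀) : ConicSpace K m m₁) :=
      hfT _ ⟨s, L₀, q₀, 1, u'₀, u''₀, isSymm_one, hlin, rfl⟩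
    let R : ℝ := |r₀| + √P.gamma1 * l2norm q₀ + 1
    have hnn : 0 ≤ √P.gamma1 * l2norm q₀ := mul_nonneg (Real.sqrt_nonneg _) (l2norm_nonneg _)
    have h2 : f ((R, M, q₀) : ConicSpace K m m₁) < c := by
      refine hfC _ ⟨?_, fun k t η h0 => borderedForm_one_pos (hs k) h0⟩
      simp only [R]
      linarith [abs_nonneg r₀]
    have h3 : ((R, M, q₀) : ConicSpace K m m₁) = ((r₀, M, q₀) : ConicSpace K m m₁) + (R - r₀) • ((1, 0, 0) : ConicSpace K m m₁) := by
      simp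
    rw [h3, map_add, map_smul, smul_eq_mul] at h2
    have h4 : 0 < R - r₀ := by
      simp only [R]
      linarith [le_abs_self r₀]
    by_contra! hcon
    have := mul_nonneg h4.le hcon
    linarith
  let τ := -f ((1, 0, 0) : ConicSpace K m m₁)
  have hτ0 : 0 < τ := by simp only [τ]; linarith
  let ψ : ConicSpace K m m₁ →ₗ[ℝ] ℝ := (-τ⁻¹) • (f : ConicSpace K m m₁ →ₗ[ℝ] ℝ)
  have hψ : ∀ e, ψ e = -τ⁻¹ * f e := fun e => rfl
  have hψT : ∀ e ∈ T, ψ e ≤ 0 := fun e he => by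
    rw [hψ, neg_mul]
    exact neg_nonpos.2 (mul_nonneg (inv_nonneg.2 hτ0.le) (hc0.trans (hfT e he)))
  have hψC : ∀ e : ConicSpace K m m₁, √P.gamma1 * l2norm e.2.2 ≤ e.1 →
      (∀ k t η, 0 ≤ borderedForm (e.2.1 k).1 (e.2.1 k).2.1 (e.2.1 k).2.2 t η) → 0 ≤ ψ e := by
    intro e h1 h2
    have h3 : (f : ConicSpace K m m₁ →ₗ[ℝ] ℝ) e ≤ 0 := by
      refine LinearMap.nonpos_of_forall_pos_add_smul (f : ConicSpace K m m₁ →ₗ[ℝ] ℝ) (e₀ := e₀) fun ε hε => ?_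
      refine hC0 _ ⟨?_, fun k t η h0 => ?_⟩
      · have h4 := (hCsmul ε hε e₀ he₀).1
        have h5 := mul_le_mul_of_nonneg_left (l2norm_add_le e.2.2 (ε • e₀).2.2)
          (Real.sqrt_nonneg P.gamma1)
        simp only [Prod.fst_add, Prod.snd_add]
        linarith
      · simp only [Prod.fst_add, Prod.snd_add, Pi.add_apply, borderedForm_add]
        exact add_pos_of_nonneg_of_pos (h2 k t η) ((hCsmul ε hε e₀ he₀).2 k t η h0)
    rw [hψ]
    have : 0 ≤ τ⁻¹ := inv_nonneg.2 hτ0.le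
    exact mul_nonneg_of_nonpos_of_nonpos (by linarith) h3
  have hψ1 : ψ ((1, 0, 0) : ConicSpace K m m₁) = 1 := by
    rw [hψ]
    simp only [τ]
    field_simp
    exact div_self hτ.ne
  let ζ : Fin K → BorderedTriple m₁ →ₗ[ℝ] ℝ := fun k => ψ ∘ₗ LinearMap.inr ℝ ℝ ((Fin K → BorderedTriple m₁) × (Fin m → ℝ)) ∘ₗ
    LinearMap.inl ℝ (Fin K → BorderedTriple m₁) (Fin m → ℝ) ∘ₗ LinearMap.single ℝ (fun _ : Fin K => BorderedTriple m₁) k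
  let π : (Fin m → ℝ) →ₗ[ℝ] ℝ := ψ ∘ₗ LinearMap.inr ℝ ℝ ((Fin K → BorderedTriple m₁) × (Fin m → ℝ)) ∘ₗ
    LinearMap.inr ℝ (Fin K → BorderedTriple m₁) (Fin m → ℝ)
  have hdecomp : ∀ (r : ℝ) (M : Fin K → BorderedTriple m₁) (q : Fin m → ℝ),
      ψ ((r, M, q) : ConicSpace K m m₁) = r + ∑ k, ζ k (M k) + π q := by
    intro r M q
    have h1 : ((r, M, q) : ConicSpace K m m₁) = r • ((1, 0, 0) : ConicSpace K m m₁) + ((0, M, 0) : ConicSpace K m m₁) + ((0, 0, q) : ConicSpace K m m₁) := by simp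
    have h2 : ((0, M, 0) : ConicSpace K m m₁) = ∑ k, ((0, Pi.single k (M k), 0) : ConicSpace K m m₁) := by
      refine Prod.ext ?_ (Prod.ext ?_ ?_) <;>
        simp [Prod.fst_sum, Prod.snd_sum, Finset.univ_sum_single]
    rw [h1, map_add, map_add, map_smul, hψ1, h2, map_sum, smul_eq_mul, mul_one]
    rfl
  let a : Fin K → (Fin m₁ → ℝ) →ₗ[ℝ] ℝ := fun k => ζ k ∘ₗ
    LinearMap.inr ℝ ℝ ((Fin m₁ → ℝ) × Matrix (Fin m₁) (Fin m₁) ℝ) ∘ₗ LinearMap.inl ℝ _ _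
  let Y : Fin K → Matrix (Fin m₁) (Fin m₁) ℝ →ₗ[ℝ] ℝ := fun k => ζ k ∘ₗ
    LinearMap.inr ℝ ℝ ((Fin m₁ → ℝ) × Matrix (Fin m₁) (Fin m₁) ℝ) ∘ₗ LinearMap.inr ℝ _ _
  let w : Fin K → ℝ := fun k => ζ k ((1, 0, 0) : BorderedTriple m₁)
  have hζ : ∀ k S u Q, ζ k ((S, u, Q) : BorderedTriple m₁) = w k * S + a k u + Y k Q := by
    intro k S u Q
    have h1 : ((S, u, Q) : BorderedTriple m₁) = S • ((1, 0, 0) : BorderedTriple m₁) + ((0, u, 0) : BorderedTriple m₁) + ((0, 0, Q) : BorderedTriple m₁) := by simp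
    rw [h1, map_add, map_add, map_smul, smul_eq_mul, mul_comm]
    rfl
  refine ⟨w, a, Y, π, fun k t η => ?_, fun q => ?_, fun s L q Q u' u'' hQ hl => ?_⟩
  · have h1 : ψ ((0, Pi.single k ((t ^ 2, (2 * t) • η, vecMulVec η η) : BorderedTriple m₁), 0) : ConicSpace K m m₁) =
        w k * t ^ 2 + 2 * t * a k η + Y k (vecMulVec η η) := by
      have : ψ ((0, Pi.single k ((t ^ 2, (2 * t) • η, vecMulVec η η) : BorderedTriple m₁), 0) : ConicSpace K m m₁) =
        ζ k ((t ^ 2, (2 * t) • η, vecMulVec η η) : BorderedTriple m₁) := rfl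
      rw [this, hζ, map_smul, smul_eq_mul]
    rw [← h1]
    refine hψC _ (by simp [l2norm_zero]) fun j t' η' => ?_
    by_cases hjk : j = k
    · subst hjk
      simp only [Pi.single_eq_same, borderedForm, ← sq_dotProduct, smul_dotProduct, smul_eq_mul]
      have := sq_nonneg (t * t' + η ⬝ᵥ η')
      linarith
    · simp [Pi.single_eq_of_ne hjk, borderedForm]
  · have h1 := hdecomp (√P.gamma1 * l2norm q) 0 q
    have h2 := hψC ((√P.gamma1 * l2norm q, 0, q) : ConicSpace K m m₁) le_rfl fun k t η => by
      simp [borderedForm]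
    rw [h1] at h2
    simpa using h2
  · have h1 := hψT _ ⟨s, L, q, Q, u', u'', hQ, hl, rfl⟩
    rw [hdecomp] at h1
    simpa only [hζ] using h1

end MomentDRO

namespace MomentDRO

variable {n m l K : ℕ} {P : MomentDRO n m l K} {m₁ m₂ : ℕ} {B₁ : Matrix (Fin m) (Fin m₁) ℝ}
  {B₂ : Matrix (Fin m) (Fin m₂) ℝ} {x : Fin n → ℝ}

/-! ### The conic dual -/

/-- Feasibility in the conic dual of the semidefinite program with fixed `B₁`, `B₂`. If `w k > 0`,
then `v k / w k` is an atom of mass `w k` attached to the `k`-th piece; `w k = 0` with `v k ≠ 0`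
describes mass escaping to infinity. The number `Y k η` bounds the second moment of the `k`-th part
in the direction `η`. -/
structure ConicFeasible (P : MomentDRO n m l K) (B₁ : Matrix (Fin m) (Fin m₁) ℝ)
    (B₂ : Matrix (Fin m) (Fin m₂) ℝ) (w : Fin K → ℝ) (v : Fin K → Fin m → ℝ)
    (Y : Fin K → (Fin m₁ → ℝ) → ℝ) : Prop where
  nonneg : ∀ k, 0 ≤ w k
  sum_eq_one : ∑ k, w k = 1
  support : ∀ k, P.A *ᵥ (P.W *ᵥ v k + w k • P.mu) ≤ w k • P.b
  orth : ∀ k, B₂ᵀ *ᵥ v k = 0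
  mean : (∑ k, v k) ⬝ᵥ (∑ k, v k) ≤ P.gamma1
  moment_nonneg : ∀ k η, 0 ≤ Y k η
  schur : ∀ k η, (η ⬝ᵥ (B₁ᵀ *ᵥ v k)) ^ 2 ≤ w k * Y k η
  moment_le : ∀ η, ∑ k, Y k η ≤ P.gamma2 * (η ⬝ᵥ η)

/-- The objective of the conic dual. -/
noncomputable def conicValue (P : MomentDRO n m l K) (x : Fin n → ℝ) (w : Fin K → ℝ) (v : Fin K → Fin m → ℝ) :
    ℝ :=
  ∑ k, (w k * (P.y0 k x + P.y k x ⬝ᵥ P.mu) + (P.Wᵀ *ᵥ P.y k x) ⬝ᵥ v k)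

theorem sq_le_mul_of_form_nonneg {w a Y : ℝ} (h : ∀ t : ℝ, 0 ≤ w * t ^ 2 + 2 * t * a + Y) :
    a ^ 2 ≤ w * Y := by
  have := discrim_le_zero (a := w) (b := 2 * a) (c := Y) fun t => by
    have := h t
    linarith
  rw [discrim] at this
  linarith

/-- The unknowns `(λ, q, u', u'')` of the polyhedral part and a homogenizing variable. -/
abbrev LinVars (K l m m₁ m₂ : ℕ) :=
  (Fin K → Fin l → ℝ) × (Fin m → ℝ) × (Fin K → Fin m₁ → ℝ) × (Fin K → Fin m₂ → ℝ) × ℝ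

theorem side_eq_mul (L : Fin l → ℝ) (q : Fin m → ℝ) (k : Fin K) :
    P.side x L q k = q + (P.Wᵀ * P.Aᵀ) *ᵥ L - P.Wᵀ *ᵥ P.y k x := by
  rw [side, mulVec_sub, mulVec_mulVec]
  abel

/-- Linear programming duality for the polyhedral part: a linear inequality valid on it is certified
by multipliers `d k` of the equations `h_k = B₁ u'_k + B₂ u''_k`. -/
theorem exists_equation_multipliers {L₀ : Fin K → Fin l → ℝ} {q₀ : Fin m → ℝ}
    {u'₀ : Fin K → Fin m₁ → ℝ} {u''₀ : Fin K → Fin m₂ → ℝ}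
    (hlin : P.LinFeasible B₁ B₂ x L₀ q₀ u'₀ u''₀) {w : Fin K → ℝ}
    {a : Fin K → (Fin m₁ → ℝ) →ₗ[ℝ] ℝ} {π : (Fin m → ℝ) →ₗ[ℝ] ℝ} {δ : ℝ}
    (h : ∀ L q u' u'', P.LinFeasible B₁ B₂ x L q u' u'' →
      ∑ k, (w k * ((P.A *ᵥ P.mu - P.b) ⬝ᵥ L k) + a k (u' k)) + π q ≤ δ) :
    ∃ d : Fin K → Fin m → ℝ, ∑ k, d k ⬝ᵥ (P.Wᵀ *ᵥ P.y k x) ≤ δ ∧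
      (∀ q, π q = (∑ k, d k) ⬝ᵥ q) ∧ (∀ k u, a k u = -(d k ⬝ᵥ (B₁ *ᵥ u))) ∧
      (∀ k u, d k ⬝ᵥ (B₂ *ᵥ u) = 0) ∧
      ∀ k e, 0 ≤ e → w k * ((P.A *ᵥ P.mu - P.b) ⬝ᵥ e) ≤ d k ⬝ᵥ ((P.Wᵀ * P.Aᵀ) *ᵥ e) := by
  classical
  let pL : LinVars K l m m₁ m₂ →ₗ[ℝ] (Fin K → Fin l → ℝ) := LinearMap.fst ℝ _ _
  let pq : LinVars K l m m₁ m₂ →ₗ[ℝ] (Fin m → ℝ) := LinearMap.fst ℝ _ _ ∘ₗ LinearMap.snd ℝ _ _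
  let pu : LinVars K l m m₁ m₂ →ₗ[ℝ] (Fin K → Fin m₁ → ℝ) :=
    LinearMap.fst ℝ _ _ ∘ₗ LinearMap.snd ℝ _ _ ∘ₗ LinearMap.snd ℝ _ _
  let pv : LinVars K l m m₁ m₂ →ₗ[ℝ] (Fin K → Fin m₂ → ℝ) :=
    LinearMap.fst ℝ _ _ ∘ₗ LinearMap.snd ℝ _ _ ∘ₗ LinearMap.snd ℝ _ _ ∘ₗ LinearMap.snd ℝ _ _
  let pt : LinVars K l m m₁ m₂ →ₗ[ℝ] ℝ :=
    LinearMap.snd ℝ _ _ ∘ₗ LinearMap.snd ℝ _ _ ∘ₗ LinearMap.snd ℝ _ _ ∘ₗ LinearMap.snd ℝ _ _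
  let eqn : Fin K → LinVars K l m m₁ m₂ →ₗ[ℝ] (Fin m → ℝ) := fun k =>
    pq + (P.Wᵀ * P.Aᵀ).mulVecLin ∘ₗ LinearMap.proj k ∘ₗ pL - B₁.mulVecLin ∘ₗ LinearMap.proj k ∘ₗ pu
      - B₂.mulVecLin ∘ₗ LinearMap.proj k ∘ₗ pv - pt.smulRight (P.Wᵀ *ᵥ P.y k x)
  let G : LinVars K l m m₁ m₂ →ₗ[ℝ] ℝ := ∑ k, ((w k • (dotProductBilin ℝ ℝ (P.A *ᵥ P.mu - P.b))) ∘ₗ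
    LinearMap.proj k ∘ₗ pL + a k ∘ₗ LinearMap.proj k ∘ₗ pu) + π ∘ₗ pq - δ • pt
  let ineq : (Fin K × Fin l) ⊕ Unit → LinVars K l m m₁ m₂ →ₗ[ℝ] ℝ := Sum.elim
    (fun i => -(LinearMap.proj i.2 ∘ₗ LinearMap.proj i.1 ∘ₗ pL)) (fun _ => -pt)
  have heqn : ∀ k L q u' u'' t, eqn k ((L, q, u', u'', t) : LinVars K l m m₁ m₂) =
      q + (P.Wᵀ * P.Aᵀ) *ᵥ L k - B₁ *ᵥ u' k - B₂ *ᵥ u'' k - t • (P.Wᵀ *ᵥ P.y k x) :=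
    fun _ _ _ _ _ _ => rfl
  have hG : ∀ L q u' u'' t, G ((L, q, u', u'', t) : LinVars K l m m₁ m₂) =
      ∑ k, (w k * ((P.A *ᵥ P.mu - P.b) ⬝ᵥ L k) + a k (u' k)) + π q - δ * t := by
    intro L q u' u'' t
    simp only [G, LinearMap.sub_apply, LinearMap.add_apply, LinearMap.sum_apply]
    rfl
  have hone : ∀ (L : Fin K → Fin l → ℝ) (q : Fin m → ℝ) (u' : Fin K → Fin m₁ → ℝ)
      (u'' : Fin K → Fin m₂ → ℝ), (∀ k, 0 ≤ L k) →
      (∀ k, eqn k ((L, q, u', u'', 1) : LinVars K l m m₁ m₂) = 0) →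
      G ((L, q, u', u'', 1) : LinVars K l m m₁ m₂) ≤ 0 := by
    intro L q u' u'' hL he
    have h1 := h L q u' u'' ⟨hL, fun k => by
      have := he k
      rw [heqn, one_smul] at this
      rw [side_eq_mul, ← sub_eq_zero, ← this]
      abel⟩
    rw [hG]
    linarith
  let z₀ : LinVars K l m m₁ m₂ := (L₀, q₀, u'₀, u''₀, 1)
  have hz₀ : ∀ k, eqn k z₀ = 0 := by
    intro k
    have := hlin.2 k
    rw [side_eq_mul] at this
    have h2 : q₀ + (P.Wᵀ * P.Aᵀ) *ᵥ L₀ k = B₁ *ᵥ u'₀ k + B₂ *ᵥ u''₀ k + P.Wᵀ *ᵥ P.y k x := by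
      rw [← this]
      abel
    simp only [z₀]
    rw [heqn, one_smul, h2]
    abel
  obtain ⟨U, D, hU, hfar⟩ := farkas ineq
    (fun j : Fin K × Fin m => LinearMap.proj j.2 ∘ₗ eqn j.1) G (by
      intro z hz he
      refine LinearMap.nonpos_of_forall_pos_add_smul G (e₀ := z₀) fun ε hε => ?_
      have ht : 0 < z.2.2.2.2 + ε := by
        have h1 : -z.2.2.2.2 ≤ 0 := hz (.inr ())
        linarith
      -- Rescale `z + ε z₀` to the slice `t = 1`.
      obtain ⟨c, hc, hct⟩ : ∃ c : ℝ, 0 < c ∧ c * (z.2.2.2.2 + ε) = 1 :=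
        ⟨_, inv_pos.2 ht, inv_mul_cancel₀ ht.ne'⟩
      have hz1 : c • (z + ε • z₀) = ((c • (z + ε • z₀)).1, (c • (z + ε • z₀)).2.1,
          (c • (z + ε • z₀)).2.2.1, (c • (z + ε • z₀)).2.2.2.1, 1) := by
        refine Prod.ext rfl (Prod.ext rfl (Prod.ext rfl (Prod.ext rfl ?_)))
        change c * (z.2.2.2.2 + ε * 1) = 1
        rw [mul_one, hct]
      have h1 := hone (c • (z + ε • z₀)).1 (c • (z + ε • z₀)).2.1
          (c • (z + ε • z₀)).2.2.1 (c • (z + ε • z₀)).2.2.2.1 (fun k i => by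
            have h2 : -z.1 k i ≤ 0 := hz (.inl (k, i))
            have h3 : 0 ≤ L₀ k i := hlin.1 k i
            change 0 ≤ c * (z.1 k i + ε * L₀ k i)
            have h4 : 0 ≤ z.1 k i := by linarith
            positivity) (fun k => by
            rw [← hz1, map_smul, map_add, map_smul, hz₀ k]
            have : eqn k z = 0 := funext fun j => he (k, j)
            rw [this]
            simp)
      rw [← hz1, map_smul, smul_eq_mul] at h1
      exact nonpos_of_mul_nonpos_right h1 hc)
  let d : Fin K → Fin m → ℝ := fun k j => D (k, j)
  have hfar' : ∀ (L : Fin K → Fin l → ℝ) (q : Fin m → ℝ) (u' : Fin K → Fin m₁ → ℝ)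
      (u'' : Fin K → Fin m₂ → ℝ) (t : ℝ),
      ∑ k, (w k * ((P.A *ᵥ P.mu - P.b) ⬝ᵥ L k) + a k (u' k)) + π q - δ * t =
      -(∑ k, (fun i => U (.inl (k, i))) ⬝ᵥ L k) - U (.inr ()) * t +
      ∑ k, d k ⬝ᵥ (q + (P.Wᵀ * P.Aᵀ) *ᵥ L k - B₁ *ᵥ u' k - B₂ *ᵥ u'' k -
        t • (P.Wᵀ *ᵥ P.y k x)) := by
    intro L q u' u'' t
    rw [← hG, hfar, Fintype.sum_sum_type, Fintype.sum_prod_type, Fintype.sum_prod_type]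
    rw [sub_eq_add_neg (-_)]
    refine congrArg₂ (· + ·) (congrArg₂ (· + ·) ?_ ?_) ?_
    · rw [← Finset.sum_neg_distrib]
      refine Finset.sum_congr rfl fun k _ => ?_
      rw [dotProduct, ← Finset.sum_neg_distrib]
      refine Finset.sum_congr rfl fun i _ => ?_
      change U (.inl (k, i)) * -L k i = _
      ring
    · rw [Fintype.sum_unique]
      change U (.inr ()) * -t = _
      ring
    · exact Finset.sum_congr rfl fun k _ => rfl
  have hδ : ∑ k, d k ⬝ᵥ (P.Wᵀ *ᵥ P.y k x) ≤ δ := by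
    have h1 := hfar' 0 0 0 0 1
    simp only [Pi.zero_apply, dotProduct_zero, mulVec_zero, map_zero, mul_zero, add_zero,
      Finset.sum_const_zero, zero_sub, sub_zero, one_smul, dotProduct_neg, Finset.sum_neg_distrib,
      mul_one, neg_zero] at h1
    linarith [hU (.inr ())]
  have hπd : ∀ q, π q = (∑ k, d k) ⬝ᵥ q := by
    intro q
    have h1 := hfar' 0 q 0 0 0
    simp only [Pi.zero_apply, dotProduct_zero, mulVec_zero, map_zero, mul_zero, add_zero,
      Finset.sum_const_zero, zero_add, sub_zero, zero_smul, neg_zero] at h1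
    rw [h1, sum_dotProduct]
  have had : ∀ k u, a k u = -(d k ⬝ᵥ (B₁ *ᵥ u)) := by
    intro k u
    have h1 := hfar' 0 0 (Pi.single k u) 0 0
    rw [Finset.sum_eq_single k, Finset.sum_eq_single k, Finset.sum_eq_single k] at h1
    · simpa using h1
    · intro j _ hj; simp [Pi.single_eq_of_ne hj]
    · simp
    · intro j _ hj; simp
    · simp
    · intro j _ hj; simp [Pi.single_eq_of_ne hj]
    · simp
  have hd₂ : ∀ k u, d k ⬝ᵥ (B₂ *ᵥ u) = 0 := by
    intro k u
    have h1 := hfar' 0 0 0 (Pi.single k u) 0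
    rw [Finset.sum_eq_single k, Finset.sum_eq_single k, Finset.sum_eq_single k] at h1
    · simpa using h1
    · intro j _ hj; simp [Pi.single_eq_of_ne hj]
    · simp
    · intro j _ hj; simp
    · simp
    · intro j _ hj; simp
    · simp
  have hsupp : ∀ k (e : Fin l → ℝ), 0 ≤ e →
      w k * ((P.A *ᵥ P.mu - P.b) ⬝ᵥ e) ≤ d k ⬝ᵥ ((P.Wᵀ * P.Aᵀ) *ᵥ e) := by
    intro k e he
    have h1 := hfar' (Pi.single k e) 0 0 0 0
    rw [Finset.sum_eq_single k, Finset.sum_eq_single k, Finset.sum_eq_single k] at h1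
    · have h2 : 0 ≤ (fun i => U (.inl (k, i))) ⬝ᵥ e :=
        dotProduct_nonneg_of_nonneg (fun i => hU _) he
      simp at h1
      rw [sub_dotProduct]
      linarith
    · intro j _ hj; simp [Pi.single_eq_of_ne hj]
    · simp
    · intro j _ hj; simp [Pi.single_eq_of_ne hj]
    · simp
    · intro j _ hj; simp [Pi.single_eq_of_ne hj]
    · simp
  exact ⟨d, hδ, hπd, had, hd₂, hsupp⟩

/-- Strong duality with the conic dual, in the case of a consistent polyhedral part. -/
theorem exists_conicFeasible {r : ℝ} {L₀ : Fin K → Fin l → ℝ} {q₀ : Fin m → ℝ}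
    {u'₀ : Fin K → Fin m₁ → ℝ} {u''₀ : Fin K → Fin m₂ → ℝ}
    (hlin : P.LinFeasible B₁ B₂ x L₀ q₀ u'₀ u''₀) (hγ : 0 ≤ P.gamma1)
    (hr : ∀ s L q Q u' u'', P.DualFeasible B₁ B₂ x s L q Q u' u'' → r ≤ P.objective s q Q) :
    ∃ w v Y, P.ConicFeasible B₁ B₂ w v Y ∧ r ≤ P.conicValue x w v := by
  classical
  obtain ⟨w, a, Y, π, hform, hπ, hmain⟩ := exists_multipliers hlin hr
  have hYadd : ∀ (Q : Matrix (Fin m₁) (Fin m₁) ℝ), Q.IsSymm →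
      ∑ k, Y k Q = P.gamma2 * Q.trace := by
    -- The left-hand side of `hmain` is affine and bounded above in the direction `Q`.
    have hle : ∀ (Q : Matrix (Fin m₁) (Fin m₁) ℝ), Q.IsSymm →
        ∑ k, Y k Q - P.gamma2 * Q.trace ≤ 0 := by
      intro Q hQ
      by_contra! hpos
      obtain ⟨N, hN⟩ := exists_nat_gt ((-(r - 0 - P.gamma2 * (0 : Matrix (Fin m₁) (Fin m₁) ℝ).trace +
        ∑ k, (w k * P.corner x 0 (L₀ k) k + a k (u'₀ k) + Y k 0) + π q₀)) /
          (∑ k, Y k Q - P.gamma2 * Q.trace))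
      rw [div_lt_iff₀ hpos] at hN
      have h1 := hmain 0 L₀ q₀ ((N : ℝ) • Q) u'₀ u''₀ (hQ.smul _) hlin
      simp only [map_smul, smul_eq_mul, trace_smul, Finset.sum_add_distrib, trace_zero, map_zero,
        Finset.sum_const_zero, ← Finset.mul_sum] at h1 hN
      linarith
    intro Q hQ
    have h1 := hle Q hQ
    have h2 := hle (-Q) hQ.neg
    simp only [map_neg, trace_neg, Finset.sum_neg_distrib] at h2
    linarith
  have hw1 : ∑ k, w k = 1 := by
    have key : ∀ s : ℝ, s * (∑ k, w k - 1) + (r + ∑ k, (w k * P.corner x 0 (L₀ k) k +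
        a k (u'₀ k)) + π q₀) ≤ 0 := by
      intro s
      have h1 := hmain s L₀ q₀ 0 u'₀ u''₀ isSymm_zero hlin
      have h2 : ∑ k, (w k * P.corner x s (L₀ k) k + a k (u'₀ k) + Y k 0) =
          s * ∑ k, w k + ∑ k, (w k * P.corner x 0 (L₀ k) k + a k (u'₀ k)) := by
        rw [Finset.mul_sum, ← Finset.sum_add_distrib]
        refine Finset.sum_congr rfl fun k _ => ?_
        rw [corner_eq_add s, map_zero]
        ring
      rw [h2, trace_zero] at h1
      linarith
    set c := r + ∑ k, (w k * P.corner x 0 (L₀ k) k + a k (u'₀ k)) + π q₀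
    by_contra hne
    have hne' : ∑ k, w k - 1 ≠ 0 := sub_ne_zero.2 hne
    have := key ((1 - c) / (∑ k, w k - 1))
    rw [div_mul_cancel₀ _ hne'] at this
    linarith
  obtain ⟨d, hδ, hπd, had, hd₂, hsupp⟩ := exists_equation_multipliers hlin (w := w) (a := a)
    (π := π) (δ := -r + ∑ k, w k * (P.y0 k x + P.y k x ⬝ᵥ P.mu)) (by
      intro L q u' u'' hL
      have h1 := hmain 0 L q 0 u' u'' isSymm_zero hL
      have h2 : ∑ k, (w k * P.corner x 0 (L k) k + a k (u' k) + Y k 0) =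
          ∑ k, (w k * ((P.A *ᵥ P.mu - P.b) ⬝ᵥ L k) + a k (u' k)) -
            ∑ k, w k * (P.y0 k x + P.y k x ⬝ᵥ P.mu) := by
        rw [← Finset.sum_sub_distrib]
        refine Finset.sum_congr rfl fun k _ => ?_
        rw [corner, map_zero, dotProduct_comm _ (L k), dotProduct_sub]
        ring
      rw [h2, trace_zero] at h1
      linarith)
  have hform' : ∀ k η, (a k η) ^ 2 ≤ w k * Y k (vecMulVec η η) := fun k η =>
    sq_le_mul_of_form_nonneg fun t => hform k t η
  have hmean : ∀ q, (∑ k, -d k) ⬝ᵥ q ≤ √P.gamma1 * l2norm q := fun q => by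
    have := hπ q
    rw [hπd] at this
    rw [Finset.sum_neg_distrib, neg_dotProduct]
    linarith
  refine ⟨w, fun k => -d k, fun k η => Y k (vecMulVec η η), ⟨fun k => ?_, hw1, fun k i => ?_,
    fun k => ?_, ?_, fun k η => ?_, fun k η => ?_, fun η => ?_⟩, ?_⟩
  · have h1 := hform k 1 0
    simpa using h1
  · have h1 := hsupp k (Pi.single i 1) (by simp)
    rw [dotProduct_single_one, dotProduct_mulVec, dotProduct_single_one, ← transpose_mul,
      vecMul_transpose, ← mulVec_mulVec] at h1
    simp only [mulVec_add, mulVec_neg, mulVec_smul, Pi.add_apply, Pi.neg_apply, Pi.smul_apply,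
      Pi.sub_apply, smul_eq_mul] at h1 ⊢
    linarith
  · rw [mulVec_neg, neg_eq_zero, mulVec_transpose]
    refine dotProduct_eq _ _ fun u => ?_
    rw [← dotProduct_mulVec, hd₂, zero_dotProduct]
  · have h1 := hmean (∑ k, -d k)
    rw [← l2norm_sq] at h1 ⊢
    have h2 := l2norm_nonneg (∑ k, -d k)
    have h3 : l2norm (∑ k, -d k) ≤ √P.gamma1 := by
      by_contra! hlt
      have h4 : 0 < l2norm (∑ k, -d k) := (Real.sqrt_nonneg _).trans_lt hlt
      have := mul_lt_mul_of_pos_right hlt h4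
      linarith [sq (l2norm (∑ k, -d k))]
    rwa [← Real.le_sqrt h2 hγ]
  · simpa using hform k 0 η
  · have h1 : η ⬝ᵥ (B₁ᵀ *ᵥ -d k) = a k η := by
      rw [had, mulVec_neg, dotProduct_neg, mulVec_transpose, dotProduct_comm η,
        ← dotProduct_mulVec]
    rw [h1]
    exact hform' k η
  · rw [hYadd _ (by ext i j; simp [vecMulVec_apply, mul_comm])]
    rw [trace_vecMulVec]
  · have h1 : P.conicValue x w (fun k => -d k) =
        ∑ k, w k * (P.y0 k x + P.y k x ⬝ᵥ P.mu) - ∑ k, d k ⬝ᵥ (P.Wᵀ *ᵥ P.y k x) := by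
      simp only [conicValue, dotProduct_neg, Finset.sum_add_distrib, Finset.sum_neg_distrib]
      simp only [dotProduct_comm (d _)]
      ring
    rw [h1]
    linarith

end MomentDRO

/-! ### From conic points to distributions -/

theorem add_sq_le_mul_of_sq_le_mul {a b w w' Y Y' : ℝ} (hw : 0 ≤ w) (hw' : 0 ≤ w') (hY : 0 ≤ Y)
    (hY' : 0 ≤ Y') (ha : a ^ 2 ≤ w * Y) (hb : b ^ 2 ≤ w' * Y') :
    (a + b) ^ 2 ≤ (w + w') * (Y + Y') := by
  have h1 : (2 * (a * b)) ^ 2 ≤ (w * Y' + w' * Y) ^ 2 := by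
    have h2 : a ^ 2 * b ^ 2 ≤ w * Y * (w' * Y') :=
      mul_le_mul ha hb (sq_nonneg b) (mul_nonneg hw hY)
    have h3 := sq_nonneg (w * Y' - w' * Y)
    linarith
  have h4 := abs_le_of_sq_le_sq' h1 (add_nonneg (mul_nonneg hw hY') (mul_nonneg hw' hY))
  linarith [h4.2]

theorem sum_sq_le_mul_of_sq_le_mul {ι : Type*} (s : Finset ι) {a w Y : ι → ℝ} (hw : ∀ i, 0 ≤ w i)
    (hY : ∀ i, 0 ≤ Y i) (h : ∀ i, a i ^ 2 ≤ w i * Y i) :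
    (∑ i ∈ s, a i) ^ 2 ≤ (∑ i ∈ s, w i) * ∑ i ∈ s, Y i := by
  classical
  induction s using Finset.induction_on with
  | empty => simp
  | insert i s hi ih =>
    rw [Finset.sum_insert hi, Finset.sum_insert hi, Finset.sum_insert hi]
    exact add_sq_le_mul_of_sq_le_mul (hw i) (Finset.sum_nonneg fun i _ => hw i) (hY i)
      (Finset.sum_nonneg fun i _ => hY i) (h i) ih

namespace MomentDRO

variable {n m l K : ℕ} {P : MomentDRO n m l K} {m₁ m₂ : ℕ} {B₁ : Matrix (Fin m) (Fin m₁) ℝ}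
  {B₂ : Matrix (Fin m) (Fin m₂) ℝ} {x : Fin n → ℝ}

/-- A conic point with positive masses is a distribution with `K` atoms. -/
theorem ConicFeasible.le_worstCase_of_pos {w : Fin K → ℝ} {v : Fin K → Fin m → ℝ}
    {Y : Fin K → (Fin m₁ → ℝ) → ℝ} (h : P.ConicFeasible B₁ B₂ w v Y) (hw : ∀ k, 0 < w k) :
    ((P.conicValue x w v : ℝ) : EReal) ≤ P.worstCase (P.DL2 B₁ B₂) x := by
  let p : Fin K → Fin m → ℝ := fun k => (w k)⁻¹ • v k
  have hp : ∀ k, w k • p k = v k := fun k => smul_inv_smul₀ (hw k).ne' _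
  have hmem : atomic w p ∈ P.DL2 B₁ B₂ := by
    refine atomic_mem_DL2 h.nonneg h.sum_eq_one (fun k => ?_) (fun k => ?_) ?_ fun η => ?_
    · rw [mem_SI_iff]
      have h1 : P.A *ᵥ (P.W *ᵥ p k + P.mu) =
          (w k)⁻¹ • (P.A *ᵥ (P.W *ᵥ v k + w k • P.mu)) := by
        rw [← mulVec_smul, smul_add, inv_smul_smul₀ (hw k).ne', ← mulVec_smul]
      rw [h1, ← inv_smul_smul₀ (hw k).ne' P.b]
      exact smul_le_smul_of_nonneg_left (h.support k) (inv_nonneg.2 (hw k).le)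
    · simp only [p, mulVec_smul, h.orth k, smul_zero]
    · simp only [hp]
      exact h.mean
    · refine (Finset.sum_le_sum fun k _ => ?_).trans (h.moment_le η)
      have h1 : w k * (η ⬝ᵥ (B₁ᵀ *ᵥ p k)) ^ 2 = (w k)⁻¹ * (η ⬝ᵥ (B₁ᵀ *ᵥ v k)) ^ 2 := by
        have := (hw k).ne'
        simp only [p, mulVec_smul, dotProduct_smul, smul_eq_mul]
        field_simp
      rw [h1, inv_mul_le_iff₀ (hw k)]
      exact h.schur k η
  have h2 := le_integral_f_atomic (P := P) (x := x) h.nonneg p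
  have h3 : ∑ k, w k * (P.y0 k x + P.y k x ⬝ᵥ (P.W *ᵥ p k + P.mu)) = P.conicValue x w v := by
    refine Finset.sum_congr rfl fun k _ => ?_
    have h4 : (P.Wᵀ *ᵥ P.y k x) ⬝ᵥ v k = w k * ((P.Wᵀ *ᵥ P.y k x) ⬝ᵥ p k) := by
      rw [← hp k, dotProduct_smul, smul_eq_mul]
    rw [dotProduct_W, h4]
    ring
  rw [h3] at h2
  exact (EReal.coe_le_coe_iff.2 h2).trans
    (le_iSup₂ (f := fun ν (_ : ν ∈ P.DL2 B₁ B₂) =>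
      ((∫ ξ, P.f x (P.W *ᵥ ξ + P.mu) ∂ν : ℝ) : EReal)) _ hmem)

/-- Mixing a conic point with the point mass at its mean makes all masses positive. -/
theorem ConicFeasible.mix {w : Fin K → ℝ} {v : Fin K → Fin m → ℝ} {Y : Fin K → (Fin m₁ → ℝ) → ℝ}
    (h : P.ConicFeasible B₁ B₂ w v Y) (hK : 1 ≤ K) {ε : ℝ} (h0 : 0 ≤ ε) (h1 : ε ≤ 1) :
    P.ConicFeasible B₁ B₂ (fun k => (1 - ε) * w k + ε * (1 / K))
      (fun k => (1 - ε) • v k + (ε * (1 / K)) • ∑ j, v j)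
      (fun k η => (1 - ε) * Y k η + ε * (1 / K) * (η ⬝ᵥ (B₁ᵀ *ᵥ ∑ j, v j)) ^ 2) := by
  have hK0 : (0 : ℝ) < K := by exact_mod_cast hK
  have h1' : 0 ≤ 1 - ε := by linarith
  have hε : 0 ≤ ε * (1 / K) := by positivity
  have hKK : (K : ℝ) * (ε * (1 / K)) = ε := by field_simp
  have hsum : ∑ k : Fin K, ((1 - ε) • v k + (ε * (1 / K)) • ∑ j, v j) = ∑ j, v j := by
    rw [Finset.sum_add_distrib, ← Finset.smul_sum, Finset.sum_const, Finset.card_univ,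
      Fintype.card_fin, ← Nat.cast_smul_eq_nsmul ℝ, smul_smul, hKK, ← add_smul, sub_add_cancel,
      one_smul]
  have hB₁sum : ∀ η, η ⬝ᵥ (B₁ᵀ *ᵥ ∑ j, v j) = ∑ j, η ⬝ᵥ (B₁ᵀ *ᵥ v j) := fun η => by
    rw [mulVec_sum, dotProduct_sum]
  refine ⟨fun k => ?_, ?_, fun k => ?_, fun k => ?_, ?_, fun k η => ?_, fun k η => ?_,
    fun η => ?_⟩
  · exact add_nonneg (mul_nonneg h1' (h.nonneg k)) hε
  · rw [Finset.sum_add_distrib, ← Finset.mul_sum, h.sum_eq_one]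
    simp only [Finset.sum_const, Finset.card_univ, Fintype.card_fin, nsmul_eq_mul]
    rw [hKK]
    ring
  · have h2 : P.A *ᵥ (P.W *ᵥ ∑ j, v j + P.mu) ≤ P.b := by
      have h3 := Finset.sum_le_sum fun k (_ : k ∈ Finset.univ) => h.support k
      rw [← mulVec_sum, Finset.sum_add_distrib, ← mulVec_sum, ← Finset.sum_smul,
        ← Finset.sum_smul, h.sum_eq_one, one_smul, one_smul] at h3
      exact h3
    have h4 : P.A *ᵥ (P.W *ᵥ ((1 - ε) • v k + (ε * (1 / K)) • ∑ j, v j) +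
        ((1 - ε) * w k + ε * (1 / K)) • P.mu) =
        (1 - ε) • (P.A *ᵥ (P.W *ᵥ v k + w k • P.mu)) +
        (ε * (1 / K)) • (P.A *ᵥ (P.W *ᵥ ∑ j, v j + P.mu)) := by
      rw [← mulVec_smul, ← mulVec_smul, ← mulVec_add]
      congr 1
      rw [mulVec_add, mulVec_smul, mulVec_smul, smul_add, smul_add, add_smul, smul_smul]
      abel
    rw [h4, add_smul, ← smul_smul (1 - ε)]
    exact add_le_add (smul_le_smul_of_nonneg_left (h.support k) h1')
      (smul_le_smul_of_nonneg_left h2 hε)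
  · rw [mulVec_add, mulVec_smul, mulVec_smul, h.orth k, mulVec_sum]
    simp [h.orth]
  · rw [hsum]
    exact h.mean
  · exact add_nonneg (mul_nonneg h1' (h.moment_nonneg k η)) (mul_nonneg hε (sq_nonneg _))
  · rw [mulVec_add, mulVec_smul, mulVec_smul, dotProduct_add, dotProduct_smul, dotProduct_smul,
      smul_eq_mul, smul_eq_mul]
    refine add_sq_le_mul_of_sq_le_mul (mul_nonneg h1' (h.nonneg k)) hε
      (mul_nonneg h1' (h.moment_nonneg k η)) (mul_nonneg hε (sq_nonneg _)) ?_ (le_of_eq (by ring))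
    have := mul_le_mul_of_nonneg_left (h.schur k η) (mul_nonneg h1' h1')
    linarith
  · rw [Finset.sum_add_distrib, ← Finset.mul_sum]
    simp only [Finset.sum_const, Finset.card_univ, Fintype.card_fin, nsmul_eq_mul]
    rw [← mul_assoc, hKK, hB₁sum]
    have h2 := sum_sq_le_mul_of_sq_le_mul Finset.univ h.nonneg (fun k => h.moment_nonneg k η)
      (fun k => h.schur k η)
    rw [h.sum_eq_one, one_mul] at h2
    have h3 := mul_le_mul_of_nonneg_left (h2.trans (h.moment_le η)) h0
    have h4 := mul_le_mul_of_nonneg_left (h.moment_le η) h1'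
    linarith

theorem conicValue_mix (w : Fin K → ℝ) (v : Fin K → Fin m → ℝ) (w' : Fin K → ℝ)
    (v' : Fin K → Fin m → ℝ) (ε : ℝ) :
    P.conicValue x (fun k => (1 - ε) * w k + ε * w' k) (fun k => (1 - ε) • v k + ε • v' k) =
      (1 - ε) * P.conicValue x w v + ε * P.conicValue x w' v' := by
  simp only [conicValue, Finset.mul_sum, ← Finset.sum_add_distrib]
  refine Finset.sum_congr rfl fun k _ => ?_
  rw [dotProduct_add, dotProduct_smul, dotProduct_smul, smul_eq_mul, smul_eq_mul]
  ring

theorem ConicFeasible.le_worstCase {w : Fin K → ℝ} {v : Fin K → Fin m → ℝ}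
    {Y : Fin K → (Fin m₁ → ℝ) → ℝ} (h : P.ConicFeasible B₁ B₂ w v Y) (hK : 1 ≤ K) :
    ((P.conicValue x w v : ℝ) : EReal) ≤ P.worstCase (P.DL2 B₁ B₂) x := by
  have hK0 : (0 : ℝ) < K := by exact_mod_cast hK
  let c := P.conicValue x w v
  let c' := P.conicValue x (fun _ : Fin K => (1 / K : ℝ)) (fun _ => (1 / K : ℝ) • ∑ j, v j)
  have hcont : Filter.Tendsto (fun ε : ℝ => (((1 - ε) * c + ε * c' : ℝ) : EReal))
      (nhdsWithin 0 (Set.Ioi 0)) (nhds (c : EReal)) := by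
    have h1 : Continuous fun ε : ℝ => (((1 - ε) * c + ε * c' : ℝ) : EReal) :=
      continuous_coe_real_ereal.comp (by fun_prop)
    have h2 := h1.tendsto 0
    simp only [sub_zero, one_mul, zero_mul, add_zero] at h2
    exact h2.mono_left nhdsWithin_le_nhds
  refine le_of_tendsto hcont ?_
  filter_upwards [Ioo_mem_nhdsGT (zero_lt_one' ℝ)] with ε hε
  have h1 := (h.mix hK hε.1.le hε.2.le).le_worstCase_of_pos (x := x) fun k => by
    have h2 := mul_nonneg (sub_nonneg.2 hε.2.le) (h.nonneg k)
    have h3 : 0 < ε * (1 / K) := mul_pos hε.1 (by positivity)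
    linarith
  have h2 : (fun k : Fin K => (1 - ε) • v k + (ε * (1 / K)) • ∑ j, v j) =
      fun k => (1 - ε) • v k + ε • ((1 / K : ℝ) • ∑ j, v j) := by
    funext k
    rw [smul_smul]
  rw [h2, conicValue_mix] at h1
  exact h1

/-! ### Strong duality -/

/-- Strong duality if the polyhedral part of the semidefinite program is consistent. -/
theorem le_worstCase_of_linFeasible {r : ℝ} {L₀ : Fin K → Fin l → ℝ} {q₀ : Fin m → ℝ}
    {u'₀ : Fin K → Fin m₁ → ℝ} {u''₀ : Fin K → Fin m₂ → ℝ} (hK : 1 ≤ K)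
    (hlin : P.LinFeasible B₁ B₂ x L₀ q₀ u'₀ u''₀) (hγ : 0 ≤ P.gamma1)
    (hr : ∀ s L q Q u' u'', P.DualFeasible B₁ B₂ x s L q Q u' u'' → r ≤ P.objective s q Q) :
    (r : EReal) ≤ P.worstCase (P.DL2 B₁ B₂) x := by
  obtain ⟨w, v, Y, h, hle⟩ := exists_conicFeasible hlin hγ hr
  exact (EReal.coe_le_coe_iff.2 hle).trans (h.le_worstCase hK)

/-- If the polyhedral part is inconsistent, there are recession directions of the support, orthogonal
to `[B₁, B₂]` and with vanishing sum, along which the pieces of the objective increase in total. -/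
theorem exists_recession (hno : ∀ L q u' u'', ¬ P.LinFeasible B₁ B₂ x L q u' u'') :
    ∃ d : Fin K → Fin m → ℝ, (∀ k, P.A *ᵥ (P.W *ᵥ d k) ≤ 0) ∧ ∑ k, d k = 0 ∧
      (∀ k, B₁ᵀ *ᵥ d k = 0) ∧ (∀ k, B₂ᵀ *ᵥ d k = 0) ∧
      0 < ∑ k, (P.Wᵀ *ᵥ P.y k x) ⬝ᵥ d k := by
  classical
  by_contra! hcon
  let E : Fin m ⊕ (Fin K × Fin m₁) ⊕ (Fin K × Fin m₂) → (Fin K → Fin m → ℝ) →ₗ[ℝ] ℝ :=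
    Sum.elim (fun j => LinearMap.proj j ∘ₗ ∑ k, LinearMap.proj k) (Sum.elim
      (fun j => LinearMap.proj j.2 ∘ₗ B₁ᵀ.mulVecLin ∘ₗ LinearMap.proj j.1)
      (fun j => LinearMap.proj j.2 ∘ₗ B₂ᵀ.mulVecLin ∘ₗ LinearMap.proj j.1))
  have hE : ∀ (j : Fin m) (d : Fin K → Fin m → ℝ), E (.inl j) d = (∑ k, d k) j := by
    intro j d
    simp [E]
  obtain ⟨U, T, hU, hfar⟩ := farkas (V := Fin K → Fin m → ℝ)
    (fun i : Fin K × Fin l =>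
      LinearMap.proj i.2 ∘ₗ (P.A * P.W).mulVecLin ∘ₗ LinearMap.proj i.1) E
    (∑ k, dotProductBilin ℝ ℝ (P.Wᵀ *ᵥ P.y k x) ∘ₗ LinearMap.proj k) (by
      intro d hd he
      have h1 := hcon d (fun k i => by
        rw [mulVec_mulVec]
        exact hd (k, i)) (funext fun j => by rw [← hE]; exact he _)
        (fun k => funext fun j => he (.inr (.inl (k, j))))
        (fun k => funext fun j => he (.inr (.inr (k, j))))
      rw [LinearMap.sum_apply]
      exact h1)
  refine hno (fun k i => U (k, i)) (fun j => T (.inl j)) (fun k j => -T (.inr (.inl (k, j))))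
    (fun k j => -T (.inr (.inr (k, j)))) ⟨fun k i => hU _, fun k => ?_⟩
  have hkey : ∀ e : Fin m → ℝ, (P.Wᵀ *ᵥ P.y k x) ⬝ᵥ e =
      (fun i => U (k, i)) ⬝ᵥ ((P.A * P.W) *ᵥ e) + (fun j => T (.inl j)) ⬝ᵥ e +
      (fun j => T (.inr (.inl (k, j)))) ⬝ᵥ (B₁ᵀ *ᵥ e) +
      (fun j => T (.inr (.inr (k, j)))) ⬝ᵥ (B₂ᵀ *ᵥ e) := by
    intro e
    have h1 := hfar (Pi.single k e)
    rw [LinearMap.sum_apply, Finset.sum_eq_single k (fun j _ hj => by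
      simp [Pi.single_eq_of_ne hj]) (by simp), Fintype.sum_prod_type, Finset.sum_eq_single k
      (fun j _ hj => by simp [Pi.single_eq_of_ne hj]) (by simp), Fintype.sum_sum_type,
      Fintype.sum_sum_type, Fintype.sum_prod_type, Fintype.sum_prod_type] at h1
    have h2 : ∑ j, ∑ i, T (.inr (.inl (j, i))) * E (.inr (.inl (j, i))) (Pi.single k e) =
        (fun j => T (.inr (.inl (k, j)))) ⬝ᵥ (B₁ᵀ *ᵥ e) := by
      rw [Finset.sum_eq_single k (fun j _ hj => by
        simp [E, Pi.single_eq_of_ne hj]) (by simp)]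
      simp [E, dotProduct, mulVec_transpose]
    have h3 : ∑ j, ∑ i, T (.inr (.inr (j, i))) * E (.inr (.inr (j, i))) (Pi.single k e) =
        (fun j => T (.inr (.inr (k, j)))) ⬝ᵥ (B₂ᵀ *ᵥ e) := by
      rw [Finset.sum_eq_single k (fun j _ hj => by
        simp [E, Pi.single_eq_of_ne hj]) (by simp)]
      simp [E, dotProduct, mulVec_transpose]
    rw [h2, h3] at h1
    simp only [hE] at h1
    have h4 : ∑ j, (Pi.single k e : Fin K → Fin m → ℝ) j = e := by simp
    rw [h4] at h1
    simp only [LinearMap.comp_apply, LinearMap.proj_apply, Pi.single_eq_same,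
      mulVecLin_apply] at h1
    rw [add_assoc, add_assoc]
    exact h1
  rw [side_eq_mul]
  refine dotProduct_eq _ _ fun e => ?_
  have h5 : (P.Wᵀ * P.Aᵀ) *ᵥ (fun i => U (k, i)) ⬝ᵥ e =
      (fun i => U (k, i)) ⬝ᵥ ((P.A * P.W) *ᵥ e) := by
    rw [← transpose_mul, mulVec_transpose, ← dotProduct_mulVec]
  have h6 : ∀ {r : ℕ} (B : Matrix (Fin m) (Fin r) ℝ) (t : Fin r → ℝ),
      B *ᵥ (fun j => -t j) ⬝ᵥ e = -(t ⬝ᵥ (Bᵀ *ᵥ e)) := by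
    intro r B t
    rw [← vecMul_transpose, ← dotProduct_mulVec, ← neg_dotProduct]
    rfl
  rw [sub_dotProduct, add_dotProduct, add_dotProduct, h5, hkey, h6, h6]
  ring

/-- If the polyhedral part is inconsistent but the ambiguity set is not empty, then mass at the mean
of some distribution can be spread along recession directions, and the worst case is infinite. -/
theorem worstCase_eq_top (hK : 1 ≤ K) {ν : Measure (Fin m → ℝ)} (hν : ν ∈ P.DL2 B₁ B₂)
    (hno : ∀ L q u' u'', ¬ P.LinFeasible B₁ B₂ x L q u' u'') :
    P.worstCase (P.DL2 B₁ B₂) x = ⊤ := by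
  obtain ⟨d, hdA, hdsum, hd₁, hd₂, hpos⟩ := exists_recession hno
  obtain ⟨hS, h₁, h₂⟩ := hν
  have := hS.1
  have hK0 : (0 : ℝ) < K := by exact_mod_cast hK
  set p := meanVec ν
  have hp₂ : B₂ᵀ *ᵥ p = 0 := by
    ext i
    have h1 : (B₂ᵀ *ᵥ p) i = ∫ ξ, B₂ᵀ i ⬝ᵥ ξ ∂ν := (integral_dotProduct hS.2.2.1 _).symm
    rw [h1, Pi.zero_apply]
    refine integral_eq_zero_of_ae ?_
    filter_upwards [h₂.ae_eq_zero] with ξ hξ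
    exact congrFun hξ i
  have hp₁ : ∀ η, (η ⬝ᵥ (B₁ᵀ *ᵥ p)) ^ 2 ≤ P.gamma2 * (η ⬝ᵥ η) := by
    intro η
    have h' := secondMomentLE_iff.1 h₁
    have h1 := h'.2.2 η
    have h2 := integrable_sq h'.1 η
    rw [smul_mulVec, one_mulVec, dotProduct_smul, smul_eq_mul] at h1
    simp only [dotProduct_mulVec] at h1 h2 ⊢
    exact (sq_dotProduct_meanVec_le hS.2.2.1 _ h2).trans h1
  have hsumK : ∑ _k : Fin K, (1 / K : ℝ) = 1 := by
    simp only [Finset.sum_const, Finset.card_univ, Fintype.card_fin, nsmul_eq_mul]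
    field_simp
  have hfeas : ∀ t : ℝ, 0 ≤ t → P.ConicFeasible B₁ B₂ (fun _ => 1 / K)
      (fun k => (1 / K : ℝ) • p + t • d k) (fun _ η => 1 / K * (η ⬝ᵥ (B₁ᵀ *ᵥ p)) ^ 2) := by
    intro t ht
    have hsum : ∑ k, ((1 / K : ℝ) • p + t • d k) = p := by
      rw [Finset.sum_add_distrib, ← Finset.sum_smul, ← Finset.smul_sum, hsumK, hdsum]
      simp
    refine ⟨fun k => by positivity, hsumK, fun k => ?_, fun k => ?_, ?_, fun k η => by positivity,
      fun k η => ?_, fun η => ?_⟩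
    · have h1 : P.A *ᵥ (P.W *ᵥ ((1 / K : ℝ) • p + t • d k) + (1 / K : ℝ) • P.mu) =
          (1 / K : ℝ) • (P.A *ᵥ (P.W *ᵥ p + P.mu)) + t • (P.A *ᵥ (P.W *ᵥ d k)) := by
        simp only [mulVec_add, mulVec_smul, smul_add]
        abel
      have h2 := smul_le_smul_of_nonneg_left (P.mem_SI_iff.1 hS.meanVec_mem) (by positivity : (0 : ℝ) ≤ 1 / K)
      have h3 := smul_le_smul_of_nonneg_left (hdA k) ht
      rw [smul_zero] at h3
      rw [h1]
      exact (add_le_add h2 h3).trans_eq (add_zero _)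
    · rw [mulVec_add, mulVec_smul, mulVec_smul, hp₂, hd₂]
      simp
    · rw [hsum]
      exact hS.2.2.2
    · rw [mulVec_add, mulVec_smul, mulVec_smul, hd₁, smul_zero, add_zero, dotProduct_smul,
        smul_eq_mul]
      exact le_of_eq (by ring)
    · rw [← Finset.sum_mul, hsumK, one_mul]
      exact hp₁ η
  have hval : ∀ t : ℝ, P.conicValue x (fun _ => 1 / K) (fun k => (1 / K : ℝ) • p + t • d k) =
      P.conicValue x (fun _ => 1 / K) (fun _ => (1 / K : ℝ) • p) +
        t * ∑ k, (P.Wᵀ *ᵥ P.y k x) ⬝ᵥ d k := by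
    intro t
    simp only [conicValue, Finset.mul_sum, ← Finset.sum_add_distrib]
    refine Finset.sum_congr rfl fun k _ => ?_
    rw [dotProduct_add, dotProduct_smul t, smul_eq_mul t]
    ring
  rw [EReal.eq_top_iff_forall_lt]
  intro c
  set c₀ := P.conicValue x (fun _ : Fin K => (1 / K : ℝ)) (fun _ => (1 / K : ℝ) • p)
  set σ := ∑ k, (P.Wᵀ *ᵥ P.y k x) ⬝ᵥ d k
  have h1 := (hfeas ((|c - c₀| + 1) / σ) (by positivity)).le_worstCase (x := x) hK
  rw [hval, div_mul_cancel₀ _ hpos.ne'] at h1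
  refine lt_of_lt_of_le (EReal.coe_lt_coe_iff.2 ?_) h1
  linarith [le_abs_self (c - c₀)]

end MomentDRO

theorem EReal.le_of_forall_real_lt {a b : EReal} (h : ∀ r : ℝ, (r : EReal) < a → (r : EReal) ≤ b) :
    a ≤ b := by
  refine le_of_forall_lt fun c hc => ?_
  obtain ⟨r, hcr, hra⟩ := EReal.lt_iff_exists_real_btwn.1 hc
  exact hcr.trans_le (h r hra)

namespace MomentDRO

variable {n m l K : ℕ} (P : MomentDRO n m l K) {m₁ m₂ : ℕ} {B₁ : Matrix (Fin m) (Fin m₁) ℝ}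
  {B₂ : Matrix (Fin m) (Fin m₂) ℝ} {x : Fin n → ℝ}

/-! ### The original problem -/

theorem secondMomentLE_isEmpty {ι : Type*} [Fintype ι] [IsEmpty ι] {ν : Measure (Fin m → ℝ)}
    {Z : (Fin m → ℝ) → (ι → ℝ)} {M : Matrix ι ι ℝ} : SecondMomentLE ν Z M :=
  ⟨fun i => isEmptyElim i, by
    rw [Subsingleton.elim (M - momentMatrix ν Z) 0]
    exact PosSemidef.zero⟩

theorem DM_eq : P.DM = P.DL2 (1 : Matrix (Fin m) (Fin m) ℝ) (0 : Matrix (Fin m) (Fin 0) ℝ) := by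
  ext ν
  have h : (fun ξ : Fin m → ℝ => (1 : Matrix (Fin m) (Fin m) ℝ)ᵀ *ᵥ ξ) = fun ξ => ξ := by
    funext ξ
    rw [transpose_one, one_mulVec]
  change _ ∧ _ ↔ _ ∧ SecondMomentLE ν (fun ξ : Fin m → ℝ => _) _ ∧ _
  rw [h]
  exact ⟨fun hν => ⟨hν.1, hν.2, secondMomentLE_isEmpty⟩, fun hν => ⟨hν.1, hν.2.1⟩⟩

theorem mFeasible_iff {s : ℝ} {L : Fin K → Fin l → ℝ} {q : Fin m → ℝ}
    {Q : Matrix (Fin m) (Fin m) ℝ} : P.MFeasible x s L q Q ↔ x ∈ P.X ∧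
      P.DualFeasible (1 : Matrix (Fin m) (Fin m) ℝ) (0 : Matrix (Fin m) (Fin 0) ℝ) x s L q Q
        (fun k => P.side x (L k) q k) (fun _ => 0) :=
  ⟨fun h => ⟨h.1, h.2.1, h.2.2, fun k => by simp⟩, fun h => ⟨h.1, h.2.1, h.2.2⟩⟩

theorem thetaM_eq_sdpM (hK : 1 ≤ K) (hγ : 0 ≤ P.gamma1) : P.thetaM = P.sdpM := by
  refine le_antisymm (le_sInf ?_) (le_iInf₂ fun x hx => ?_)
  · rintro _ ⟨x, s, L, q, Q, h, rfl⟩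
    refine (iInf₂_le x h.1).trans ?_
    rw [DM_eq]
    exact (P.mFeasible_iff.1 h).2.worstCase_le hK
  · rw [DM_eq]
    refine EReal.le_of_forall_real_lt fun r hr => ?_
    refine le_worstCase_of_linFeasible hK (L₀ := 0) (q₀ := 0) (u'₀ := fun k => P.side x 0 0 k)
      (u''₀ := 0) ⟨fun k => le_rfl, fun k => by simp⟩ hγ ?_
    intro s L q Q u' u'' h
    have hu : u' = fun k => P.side x (L k) q k := by
      funext k
      rw [h.side_eq k]
      simp
    subst hu
    have h1 : P.MFeasible x s L q Q := ⟨hx, h.1, h.2⟩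
    exact EReal.coe_le_coe_iff.1 (hr.le.trans h1.sdpM_le)

/-! ### The outer approximation -/

theorem outerL2_le_thetaL2 (hK : 1 ≤ K) (m₁ : ℕ) : P.outerL2 m₁ ≤ P.thetaL2 m₁ := by
  refine le_sInf ?_
  rintro _ ⟨x, s, L, q, Q, u', u'', B₁, B₂, ⟨hx, hL, hB, hQ, hside⟩, rfl⟩
  rw [outerL2]
  exact iInf_le_of_le B₁ <| iInf_le_of_le B₂ <| iInf_le_of_le hB <| (iInf₂_le x hx).trans <|
    DualFeasible.worstCase_le ⟨hL, hQ, hside⟩ hK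

theorem DM_subset_DL2 [IsEmpty (Fin m₂)] (hB₁ : B₁ᵀ * B₁ = 1) : P.DM ⊆ P.DL2 B₁ B₂ := by
  rintro ν ⟨hS, h⟩
  refine ⟨hS, ?_, secondMomentLE_isEmpty⟩
  rw [secondMomentLE_iff] at h ⊢
  refine ⟨fun i j => ?_, by simp [IsSymm], fun η => ?_⟩
  · have h1 := integrable_form h.1 (vecMulVec (B₁ᵀ i) (B₁ᵀ j))
    refine h1.congr (Filter.Eventually.of_forall fun ξ => ?_)
    beta_reduce
    rw [dotProduct_mulVec_eq_sum]
    simp only [vecMulVec_apply, mulVec, dotProduct, Finset.sum_mul_sum]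
    exact Finset.sum_congr rfl fun a _ => Finset.sum_congr rfl fun b _ => by ring
  · have h1 := h.2.2 (B₁ *ᵥ η)
    rw [smul_mulVec, one_mulVec, dotProduct_smul] at h1 ⊢
    have h2 : B₁ *ᵥ η ⬝ᵥ B₁ *ᵥ η = η ⬝ᵥ η := by
      rw [dotProduct_mulVec, vecMul_mulVec, hB₁, vecMul_one]
    rw [h2] at h1
    refine le_trans (le_of_eq ?_) h1
    refine integral_congr_ae (Filter.Eventually.of_forall fun ξ => ?_)
    simp only
    rw [dotProduct_mulVec, vecMul_transpose]

theorem thetaM_le_outerL2 : P.thetaM ≤ P.outerL2 K := by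
  have : IsEmpty (Fin (K - K)) := by rw [Nat.sub_self]; infer_instance
  refine le_iInf fun B₁ => le_iInf fun B₂ => le_iInf fun hB => le_iInf₂ fun x hx => ?_
  exact (iInf₂_le x hx).trans (biSup_mono (P.DM_subset_DL2 (orthonormal₂_iff.1 hB).1))

/-- If an ambiguity set is empty, then the low-dimensional semidefinite program is unbounded below,
possibly along other matrices `B₁`, `B₂`. Duality for the zero objective gives a ray
`(s, λ, q)` certifying the emptiness; it survives in any system whose second part `B₂` spans
`q + Wᵀ Aᵀ λ`, and the remaining columns can absorb the `K - 1` differences of the slopes. -/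
theorem thetaL2_eq_bot (hK : 1 ≤ K) (hKm : K ≤ m) (hγ₁ : 0 ≤ P.gamma1) (hγ₂ : 0 ≤ P.gamma2)
    (hm₁ : m₁ < K) (hx : x ∈ P.X) (hempty : P.DL2 B₁ B₂ = ∅) : P.thetaL2 m₁ = ⊥ := by
  let P₀ : MomentDRO n m l K := { P with y0 := fun _ => 0, y := fun _ => 0 }
  let k₀ : Fin K := ⟨0, hK⟩
  obtain ⟨s, L, q, Q, u', u'', hf, hneg⟩ : ∃ s L q Q u' u'',
      P₀.DualFeasible B₁ B₂ x s L q Q u' u'' ∧ P₀.objective s q Q < 0 := by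
    by_contra! hcon
    have h1 := le_worstCase_of_linFeasible (P := P₀) (x := x) (B₁ := B₁) (B₂ := B₂) (r := 0) hK
      (L₀ := 0) (q₀ := 0) (u'₀ := 0) (u''₀ := 0)
      ⟨fun k => le_rfl, fun k => by simp [side, P₀]⟩ hγ₁ hcon
    have h2 : P₀.DL2 B₁ B₂ = ∅ := hempty
    rw [h2, worstCase] at h1
    simp at h1
  have hsq : s + √P.gamma1 * l2norm q < 0 := by
    have h1 : 0 ≤ P.gamma2 * Q.trace :=
      mul_nonneg hγ₂ (bordered_posSemidef_block (hf.posSemidef k₀)).trace_nonneg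
    have h2 : s + P.gamma2 * matInner 1 Q + √P.gamma1 * l2norm q < 0 := hneg
    rw [matInner_one] at h2
    linarith
  set Λ := L k₀
  have hcorner : 0 ≤ s - Λ ⬝ᵥ P.b + Λ ⬝ᵥ (P.A *ᵥ P.mu) := by
    have h1 := bordered_posSemidef_corner (hf.posSemidef k₀)
    have h2 : P₀.corner x s Λ k₀ = s - 0 - Λ ⬝ᵥ P.b - 0 ⬝ᵥ P.mu + Λ ⬝ᵥ (P.A *ᵥ P.mu) := rfl
    rw [h2, zero_dotProduct] at h1
    linarith
  let g := q + (P.Wᵀ * P.Aᵀ) *ᵥ Λ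
  let c : Fin K → Fin m → ℝ := fun k => P.Wᵀ *ᵥ P.y k₀ x - P.Wᵀ *ᵥ P.y k x
  obtain ⟨C₁, C₂, hC, hrange, hzero⟩ := exists_orthonormal₂ hKm hm₁.le
    fun k => if k = k₀ then g else c k
  have hg₁ : C₁ᵀ *ᵥ g = 0 := by simpa using hzero k₀ rfl hm₁
  have hg : g = C₂ *ᵥ (C₂ᵀ *ᵥ g) := by
    have := hrange k₀
    simp only [if_true] at this
    rwa [hg₁, mulVec_zero, zero_add] at this
  have hc : ∀ k, c k = C₁ *ᵥ (C₁ᵀ *ᵥ c k) + C₂ *ᵥ (C₂ᵀ *ᵥ c k) := by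
    intro k
    by_cases hk : k = k₀
    · subst hk
      simp [c]
    · simpa [hk] using hrange k
  obtain ⟨s₀, hs₀⟩ := exists_slater (P := P) (x := x) 0 fun k => C₁ᵀ *ᵥ c k
  have hfeas : ∀ t : ℝ, 0 ≤ t → P.L2Feasible m₁ x (s₀ + t * s) (fun _ => t • Λ)
      (P.Wᵀ *ᵥ P.y k₀ x + t • q) 1 (fun k => C₁ᵀ *ᵥ c k)
      (fun k => C₂ᵀ *ᵥ c k + t • (C₂ᵀ *ᵥ g)) C₁ C₂ := by
    intro t ht
    refine ⟨hx, fun k => smul_nonneg ht (hf.nonneg k₀), hC, fun k => ?_, fun k => ?_⟩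
    · refine bordered_one_posSemidef ?_
      have h1 := hs₀ k
      have h2 := mul_nonneg ht hcorner
      simp only [corner, smul_dotProduct, smul_eq_mul, Pi.zero_apply, zero_dotProduct] at h1 ⊢
      linarith
    · have h1 : P.side x (t • Λ) (P.Wᵀ *ᵥ P.y k₀ x + t • q) k = c k + t • g := by
        rw [side_eq_mul, mulVec_smul]
        simp only [c, g, smul_add]
        abel
      rw [h1]
      change _ = C₁ *ᵥ (C₁ᵀ *ᵥ c k) + C₂ *ᵥ (C₂ᵀ *ᵥ c k + t • (C₂ᵀ *ᵥ g))
      rw [mulVec_add C₂, mulVec_smul, ← hg, ← add_assoc, ← hc k]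
  rw [EReal.eq_bot_iff_forall_lt]
  intro y
  let D := s₀ + P.gamma2 * (1 : Matrix (Fin m₁) (Fin m₁) ℝ).trace +
    √P.gamma1 * l2norm (P.Wᵀ *ᵥ P.y k₀ x)
  let σ := -(s + √P.gamma1 * l2norm q)
  have hσ : 0 < σ := by simp only [σ]; linarith
  let t := (|D - y| + 1) / σ
  have ht : 0 ≤ t := by positivity
  have htσ : t * σ = |D - y| + 1 := div_mul_cancel₀ _ hσ.ne'
  refine lt_of_le_of_lt (hfeas t ht).thetaL2_le (EReal.coe_lt_coe_iff.2 ?_)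
  have h1 := mul_le_mul_of_nonneg_left (l2norm_add_le (P.Wᵀ *ᵥ P.y k₀ x) (t • q))
    (Real.sqrt_nonneg P.gamma1)
  rw [l2norm_smul ht] at h1
  simp only [objective, matInner_one]
  have h2 := le_abs_self (D - y)
  simp only [D, σ] at h2 htσ
  linarith

theorem thetaL2_le_worstCase (hK : 1 ≤ K) (hKm : K ≤ m) (hγ₁ : 0 ≤ P.gamma1)
    (hγ₂ : 0 ≤ P.gamma2) (hm₁ : m₁ < K) {B₂ : Matrix (Fin m) (Fin (K - m₁)) ℝ}
    (hB : Orthonormal₂ B₁ B₂) (hx : x ∈ P.X) :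
    P.thetaL2 m₁ ≤ P.worstCase (P.DL2 B₁ B₂) x := by
  rcases (P.DL2 B₁ B₂).eq_empty_or_nonempty with hempty | ⟨ν, hν⟩
  · rw [P.thetaL2_eq_bot hK hKm hγ₁ hγ₂ hm₁ hx hempty]
    exact bot_le
  by_cases hlin : ∃ L q u' u'', P.LinFeasible B₁ B₂ x L q u' u''
  · obtain ⟨L₀, q₀, u'₀, u''₀, hlin⟩ := hlin
    refine EReal.le_of_forall_real_lt fun r hr => le_worstCase_of_linFeasible hK hlin hγ₁ ?_
    intro s L q Q u' u'' h
    have h1 : P.L2Feasible m₁ x s L q Q u' u'' B₁ B₂ := ⟨hx, h.1, hB, h.2, h.3⟩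
    exact EReal.coe_le_coe_iff.1 (hr.le.trans h1.thetaL2_le)
  · push Not at hlin
    rw [worstCase_eq_top hK hν hlin]
    exact le_top

theorem outerL2_eq_thetaL2 (hK : 1 ≤ K) (hKm : K ≤ m) (hγ₁ : 0 ≤ P.gamma1)
    (hγ₂ : 0 ≤ P.gamma2) (hm₁ : m₁ ≤ K) : P.outerL2 m₁ = P.thetaL2 m₁ := by
  refine le_antisymm (P.outerL2_le_thetaL2 hK m₁) ?_
  rcases hm₁.lt_or_eq with hlt | rfl
  · exact le_iInf fun B₁ => le_iInf fun B₂ => le_iInf fun hB => le_iInf₂ fun x hx =>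
      P.thetaL2_le_worstCase hK hKm hγ₁ hγ₂ hlt hB hx
  · refine (P.thetaL2_le_sdpM hKm le_rfl hγ₂ hK).trans ?_
    rw [← P.thetaM_eq_sdpM hK hγ₁]
    exact P.thetaM_le_outerL2

end MomentDRO

theorem theorem6 {n m l K : ℕ} (P : MomentDRO n m l K) (hP : P.Standing)
    (hK : 1 ≤ K) (hKm : K ≤ m) :
    (∀ m₁ : ℕ, m₁ ≤ K → P.outerL2 m₁ = P.thetaL2 m₁) ∧
    P.thetaM = P.sdpM ∧
    (∀ m₁ : ℕ, m₁ ≤ K → P.thetaL2 m₁ ≤ P.thetaM) ∧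
    (∀ m₁ m₂ : ℕ, m₁ < m₂ → m₂ ≤ K → P.thetaL2 m₁ ≤ P.thetaL2 m₂) ∧
    P.thetaL2 K = P.thetaM := by
  have hγ₁ := hP.gamma1_nonneg
  have hγ₂ : 0 ≤ P.gamma2 := zero_le_one.trans hP.one_le_gamma2
  have hM := P.thetaM_eq_sdpM hK hγ₁
  refine ⟨fun m₁ h => P.outerL2_eq_thetaL2 hK hKm hγ₁ hγ₂ h, hM, fun m₁ h => ?_,
    fun m₁ m₂ h h' => P.thetaL2_mono hγ₂ hK h.le h', ?_⟩
  · rw [hM]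
    exact P.thetaL2_le_sdpM hKm h hγ₂ hK
  · rw [hM]
    exact le_antisymm (P.thetaL2_le_sdpM hKm le_rfl hγ₂ hK) P.sdpM_le_thetaL2
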